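/- Let $\mathcal X\subset\mathbb R^d$, let $\mathcal S\subset\mathbb R$ be an interval, and let $(X,S)$ be a random pair with values in $\mathcal X\times\mathcal S$ and law $P$. Assume the following. (1) $k:\mathbb R\to[0,\infty)$ is measurable, bounded and symmetric, with $\int k=1$ and $\int t^2k(t)\,dt<\infty$; put $K_\gamma(s,s')=k((s-s')/\gamma)$. (2) $S$ has a density $q$ with respect to Lebesgue measure on $\mathcal S$, and $L<q(s)<U$ on $\mathcal S$ for some constants $0<L<U<\infty$. (3) There is a $\sigma$-finite measure $\mu$ on $\mathcal X$ such that $P$ has a density $p(x,s)\ge 0$ with respect to the product of $\mu$ and Lebesgue measure on $\mathcal S$. For every $x$, the function $s\mapsto p(x,s)$ is twice differentiable on $\mathcal S$ with bounded second derivative, and $\sup_{s\in\mathcal S}\int|\partial_s^2p(x,s)|\,\mu(dx)<\infty$. (4) The bandwidths satisfy $\gamma_n\to0$ and $n\gamma_n\to\infty$. For a class $\mathcal V$ of functions write $\mathrm{IPM}_{\mathcal V}(Q,Q')=\sup_{v\in\mathcal V}\left|\int v\,dQ-\int v\,dQ'\right|$. For $Z=h(X)$ put $$\mathrm{EIPM}_{\mathcal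 V}(Z;S)=\mathbb E_S\left[\mathrm{IPM}_{\mathcal V}(P_{Z\mid S},P_Z)\right].$$ For an i.i.d. sample $(X_1,S_1),\dots,(X_n,S_n)$ from $P$ with $Z_i=h(X_i)$ put $$\widehat{\mathrm{EIPM}}{}^{\gamma}_{\mathcal V}(Z;S)=\frac1n\sum_{i=1}^n\mathrm{IPM}_{\mathcal V}\left(\sum_{j\ne i}\frac{K_\gamma(S_j,S_i)}{\sum_{l\ne i}K_\gamma(S_l,S_i)}\,\delta_{Z_j},\ \frac1{n-1}\sum_{j\ne i}\delta_{Z_j}\right).$$ Let $\mathcal N(\epsilon,\mathcal V,\|\cdot\|_\infty)$ be the least number of sup-norm balls of radius $\epsilon$ (sup norm over $\mathcal Z$, centres not required to lie in $\mathcal V$) that cover $\mathcal V$. **Theorem.** There is a constant $c>0$ such that the following holds for every $m$, every measurable $\mathcal Z\subset\mathbb R^m$, every bounded measurable encoder $h:\mathcal X\to\mathcal Z$, and every nonempty class $\mathcal V$ of measurable functions $v:\mathcal Z\to\mathbb R$ with $\|v\|_\infty\le1$. With $$\epsilon_n=\gamma_n^2+\frac{\log n}{\sqrt{n\gamma_n}}\left(1+\log\mathcal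 N\left(\sqrt{\gamma_n/n},\mathcal V,\|\cdot\|_\infty\right)\right)^{1/2},$$ for all sufficiently large $n$, with probability at least $1-4/n$, $$\left|\widehat{\mathrm{EIPM}}{}^{\gamma_n}_{\mathcal V}(Z;S)-\mathrm{EIPM}_{\mathcal V}(Z;S)\right|<c\,\epsilon_n .$$ Here $c$ does not depend on $n$, $m$, $\mathcal Z$, $h$ or $\mathcal V$, whereas how large $n$ must be may depend on them. If the covering number is infinite, then $\epsilon_n=\infty$ and nothing is claimed. -/

import Mathlib

open MeasureTheory ProbabilityTheory Filter Topology
open scoped NNReal ENNReal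

noncomputable section

/-- The integral probability metric with discriminator class `V`. -/
def IPM {E : Type*} [MeasurableSpace E] (V : Set (E → ℝ)) (P Q : Measure E) : ℝ :=
  ⨆ v : V, |∫ z, (v : E → ℝ) z ∂P - ∫ z, (v : E → ℝ) z ∂Q|

/-- The expectation, over the law of `S`, of the IPM between the conditional law of `Z` given `S`
and the marginal law of `Z`. -/
def EIPM {Ω E : Type*} [MeasurableSpace Ω] [MeasurableSpace E] [StandardBorelSpace E] [Nonempty E]
    (V : Set (E → ℝ)) (Z : Ω → E) (S : Ω → ℝ) (μ : Measure Ω) [IsFiniteMeasure μ] : ℝ :=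
  ∫ s, IPM V (condDistrib Z S μ s) (μ.map Z) ∂(μ.map S)

/-- The kernel with profile `k` and bandwidth `γ`. -/
def smoothingKernel (k : ℝ → ℝ) (γ s s' : ℝ) : ℝ := k ((s - s') / γ)

/-- The leave-one-out kernel weight of the sample point `j` when the `i`-th one is excluded. -/
def kernelWeight (k : ℝ → ℝ) (γ : ℝ) {n : ℕ} (S : Fin n → ℝ) (j i : Fin n) : ℝ :=
  smoothingKernel k γ (S j) (S i) / ∑ l ∈ Finset.univ.erase i, smoothingKernel k γ (S l) (S i)

/-- The leave-one-out kernel-weighted empirical measure that estimates the conditional law of `Z`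
given `S = S i`. -/
def condEmpirical {E : Type*} [MeasurableSpace E] (k : ℝ → ℝ) (γ : ℝ) {n : ℕ}
    (Z : Fin n → E) (S : Fin n → ℝ) (i : Fin n) : Measure E :=
  ∑ j ∈ Finset.univ.erase i, ENNReal.ofReal (kernelWeight k γ S j i) • Measure.dirac (Z j)

/-- The leave-one-out empirical measure that estimates the law of `Z`. -/
def margEmpirical {E : Type*} [MeasurableSpace E] {n : ℕ} (Z : Fin n → E) (i : Fin n) :
    Measure E :=
  ∑ j ∈ Finset.univ.erase i, ENNReal.ofReal (1 / ((n : ℝ) - 1)) • Measure.dirac (Z j)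

/-- The leave-one-out kernel-smoothed estimator of the EIPM. -/
def EIPMhat {E : Type*} [MeasurableSpace E] (V : Set (E → ℝ)) (k : ℝ → ℝ) (γ : ℝ) {n : ℕ}
    (Z : Fin n → E) (S : Fin n → ℝ) : ℝ :=
  (1 / (n : ℝ)) * ∑ i, IPM V (condEmpirical k γ Z S i) (margEmpirical Z i)

/-- The least number of closed sup-norm balls of radius `ε` (the sup norm being taken over `A`, the
centres being arbitrary functions on `A`) that cover the class `V`; it is `⊤` if no finite number
of them does. -/
def supCoveringNumber {E : Type*} (ε : ℝ) (A : Set E) (V : Set (E → ℝ)) : ℕ∞ :=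
  Metric.externalCoveringNumber ε.toNNReal ((fun v => UniformFun.ofFun (fun z : A => v z)) '' V)

/-- The rate `γ² + (log n / √(n γ)) (1 + log N) ^ (1/2)`, for a finite covering number `N`. -/
def eipmRate (n : ℕ) (γ : ℝ) (N : ℕ∞) : ℝ :=
  γ ^ 2 + Real.log n / √(n * γ) * √(1 + Real.log (N.toNat : ℝ))

/-- Symmetric bounded nonnegative profile of mass one with finite second moment. -/
structure IsKernelProfile (k : ℝ → ℝ) : Prop where
  measurable : Measurable k
  nonneg : ∀ t, 0 ≤ k t
  bounded : ∃ M : ℝ, ∀ t, k t ≤ M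
  integral_eq_one : ∫ t, k t = 1
  second_moment : Integrable (fun t => t ^ 2 * k t)
  symm : ∀ t, k t = k (-t)

/-- `PS` has, with respect to Lebesgue measure on `𝒮`, a density that lies strictly between two
positive constants on `𝒮`. -/
def HasBoundedDensity (PS : Measure ℝ) (𝒮 : Set ℝ) : Prop :=
  ∃ q : ℝ → ℝ, Measurable q ∧
    PS = (volume.restrict 𝒮).withDensity (fun s => ENNReal.ofReal (q s)) ∧
    ∃ L U : ℝ, 0 < L ∧ L < U ∧ ∀ s ∈ 𝒮, L < q s ∧ q s < U

/-- `P` has a density `p` with respect to the product of a σ-finite measure `μX` and Lebesgue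
measure on `𝒮`, such that `p x` is twice differentiable on `𝒮` with bounded second derivative for
every `x`, and the integral over `x` of the absolute value of the second derivative is bounded
on `𝒮`. -/
def HasSmoothDensity {X : Type*} [MeasurableSpace X] (P : Measure (X × ℝ)) (𝒮 : Set ℝ) : Prop :=
  ∃ (μX : Measure X) (p : X → ℝ → ℝ), SigmaFinite μX ∧ Measurable (Function.uncurry p) ∧
    (∀ x, ∀ s ∈ 𝒮, 0 ≤ p x s) ∧
    P = (μX.prod (volume.restrict 𝒮)).withDensity (fun w => ENNReal.ofReal (p w.1 w.2)) ∧
    (∀ x, DifferentiableOn ℝ (p x) 𝒮 ∧ DifferentiableOn ℝ (derivWithin (p x) 𝒮) 𝒮 ∧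
      ∃ B : ℝ, ∀ s ∈ 𝒮, |derivWithin (derivWithin (p x) 𝒮) 𝒮 s| ≤ B) ∧
    ∃ B : ℝ≥0, ∀ s ∈ 𝒮, ∫⁻ x, ‖derivWithin (derivWithin (p x) 𝒮) 𝒮 s‖ₑ ∂μX ≤ B

end

/-!
The error of the leave-one-out estimator is split into an approximation error of the discriminator
class, a stochastic error and a bias.

*Stochastic error.* Given the excluded point, the numerator and the denominator of the kernel
average are sums of i.i.d. variables that are bounded and, because the marginal density is bounded,
have second moment of order `γ`. A Bernstein inequality (`pi_abs_sum_sub_integral_ge_le`), carried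
over to leave-one-out sums by Fubini (`pi_leaveOneOut_le`), bounds their deviations by a multiple of
`√(ℓ n γ)` with probability `1 - 2 exp (-ℓ)`. The denominator is of order `n γ`, since an interval
extends to a fixed distance on at least one side of each of its points
(`exists_forall_kernel_mass_ge`). So each kernel average is within `O(√(ℓ / (n γ)))` of the ratio of
the means. The class is replaced by a finite net of radius `2 √(γ / n)` with at most `K` elements,
`K` being the covering number, and the union bound with `ℓ = 3 log n + log K` produces the
stochastic part of the rate.

*Bias.* For a weight `w` on `𝒳` let `m w s = ∫ w(x) p(x, s) μ(dx)`. The conditional mean of `w(X)`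
given `S = s` is `m w s / m 1 s` (`IsSmoothDisintegration.integral_condDistrib_eq`). The bound on
the mean of `|∂²p|` gives `m w` a first-order Taylor expansion with quadratic remainder and bounded
slope, uniformly in `w` (`lintegral_taylor_le`, `exists_isSmoothDisintegration`). The quadratic part
contributes `O(γ ^ 2)`. The linear part is killed by the symmetry of the kernel up to the first
moment of the kernel mass that falls outside `𝒮` (`boundaryMoment`). Divided by `γ`, this moment is
only `O(γ)` near the boundary, but its mean is `O(γ ^ 2)`, because a shift by `u` moves a set of
measure at most `|u|` out of an interval (`setIntegral_boundaryMoment_le`); this is where the second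
moment of the kernel is used. As the estimator averages over the sample, only that mean matters.

The average of the population IPM over the sample concentrates around the EIPM. Its measurability as
a function of `s` comes from the nets: if the covering numbers are finite for infinitely many `n`,
the class is totally bounded and the IPM is a uniform limit of finite suprema
(`aemeasurable_IPM_kernel`); otherwise nothing is claimed for large `n`. Finally, if
`√(ℓ / (n γ))` is not small, the rate is bounded below and the trivial bound `4` on the error
suffices, so no relation between `n γ` and `log n` is needed.
-/

/-! ### Concentration of sums of independent variables -/

/-- Bennett-type bound on the moment generating function of a centred bounded variable, from
`exp x ≤ 1 + x + x ^ 2` on `[-1, 1]`. -/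
theorem mgf_le_exp_of_abs_le {W : Type*} [MeasurableSpace W] {P : Measure W}
    [IsProbabilityMeasure P] {f : W → ℝ} (hf : Measurable f) {C σ t : ℝ} (hC : ∀ w, |f w| ≤ C)
    (h0 : ∫ w, f w ∂P = 0) (h2 : ∫ w, f w ^ 2 ∂P ≤ σ) (ht : |t| * C ≤ 1) :
    mgf f P t ≤ Real.exp (t ^ 2 * σ) := by
  have hfi : Integrable f P := Integrable.of_bound hf.aestronglyMeasurable C
    (Eventually.of_forall hC)
  have hf2 : Integrable (fun w => f w ^ 2) P :=
    Integrable.of_bound (hf.pow_const 2).aestronglyMeasurable (C ^ 2)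
      (Eventually.of_forall fun w => by
        rw [Real.norm_eq_abs, abs_pow]
        exact pow_le_pow_left₀ (abs_nonneg _) (hC w) 2)
  have hpt : ∀ w, |t * f w| ≤ 1 := fun w => by
    rw [abs_mul]
    exact (mul_le_mul_of_nonneg_left (hC w) (abs_nonneg t)).trans ht
  have hle : ∀ w, Real.exp (t * f w) ≤ 1 + t * f w + t ^ 2 * f w ^ 2 := fun w => by
    have := (abs_le.1 (Real.abs_exp_sub_one_sub_id_le (hpt w))).2
    nlinarith
  have hexp : Integrable (fun w => Real.exp (t * f w)) P :=
    Integrable.of_bound (Real.measurable_exp.comp (hf.const_mul t)).aestronglyMeasurable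
      (Real.exp 1) (Eventually.of_forall fun w => by
        rw [Real.norm_eq_abs, Real.abs_exp]
        exact Real.exp_le_exp.2 ((le_abs_self _).trans (hpt w)))
  have hi1 : Integrable (fun w => 1 + t * f w) P :=
    (integrable_const (1 : ℝ)).add (hfi.const_mul t)
  calc mgf f P t = ∫ w, Real.exp (t * f w) ∂P := rfl
    _ ≤ ∫ w, (1 + t * f w + t ^ 2 * f w ^ 2) ∂P :=
        integral_mono hexp (hi1.add (hf2.const_mul _)) hle
    _ = 1 + t ^ 2 * ∫ w, f w ^ 2 ∂P := by
        rw [integral_add hi1 (hf2.const_mul _),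
          integral_add (integrable_const (1 : ℝ)) (hfi.const_mul t)]
        simp [integral_const_mul, h0]
    _ ≤ 1 + t ^ 2 * σ := by gcongr
    _ ≤ Real.exp (t ^ 2 * σ) := by linarith [Real.add_one_le_exp (t ^ 2 * σ)]

/-- One-sided Chernoff bound for a sum of i.i.d. centred bounded variables. -/
theorem pi_sum_ge_le_exp {W ι : Type*} [MeasurableSpace W] [Fintype ι] {P : Measure W}
    [IsProbabilityMeasure P] {f : W → ℝ} (hf : Measurable f) {C σ t a : ℝ}
    (hC : ∀ w, |f w| ≤ C) (h0 : ∫ w, f w ∂P = 0) (h2 : ∫ w, f w ^ 2 ∂P ≤ σ) (ht0 : 0 ≤ t)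
    (ht : t * C ≤ 1) :
    (Measure.pi fun _ : ι => P) {ω | a ≤ ∑ i, f (ω i)} ≤
      ENNReal.ofReal (Real.exp (-t * a + Fintype.card ι * (t ^ 2 * σ))) := by
  have hind : iIndepFun (fun (i : ι) (ω : ι → W) => f (ω i)) (Measure.pi fun _ : ι => P) :=
    iIndepFun_pi (fun _ => hf.aemeasurable)
  have hm : ∀ i : ι, Measurable fun ω : ι → W => f (ω i) := fun i => hf.comp (measurable_pi_apply i)
  have hX : Measurable fun ω : ι → W => ∑ i, f (ω i) :=
    Finset.measurable_sum _ fun i _ => hm i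
  have hint : Integrable (fun ω : ι → W => Real.exp (t * ∑ i, f (ω i)))
      (Measure.pi fun _ : ι => P) :=
    Integrable.of_bound (Real.measurable_exp.comp (hX.const_mul t)).aestronglyMeasurable
      (Real.exp (t * ∑ _i : ι, C)) (Eventually.of_forall fun ω => by
        rw [Real.norm_eq_abs, Real.abs_exp]
        exact Real.exp_le_exp.2 (mul_le_mul_of_nonneg_left
          (Finset.sum_le_sum fun i _ => (le_abs_self _).trans (hC _)) ht0))
  have hmgf : mgf (fun ω : ι → W => ∑ i, f (ω i)) (Measure.pi fun _ : ι => P) t ≤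
      Real.exp (Fintype.card ι * (t ^ 2 * σ)) := by
    have h := hind.mgf_sum (t := t) hm Finset.univ
    have h' : (∑ i : ι, fun ω : ι → W => f (ω i)) = fun ω => ∑ i, f (ω i) := by
      ext ω; simp
    rw [h'] at h
    rw [h]
    have hone : ∀ i : ι, mgf (fun ω : ι → W => f (ω i)) (Measure.pi fun _ : ι => P) t ≤
        Real.exp (t ^ 2 * σ) := fun i => by
      have hmp := measurePreserving_eval (fun _ : ι => P) i
      have : mgf (fun ω : ι → W => f (ω i)) (Measure.pi fun _ : ι => P) t = mgf f P t := by
        have h1 := mgf_map (X := f) (t := t) (μ := Measure.pi fun _ : ι => P)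
          hmp.measurable.aemeasurable
          (Real.measurable_exp.comp (hf.const_mul t)).aestronglyMeasurable
        rw [hmp.map_eq] at h1
        exact h1.symm
      rw [this]
      exact mgf_le_exp_of_abs_le hf hC h0 h2 (by rwa [abs_of_nonneg ht0])
    calc ∏ i : ι, mgf (fun ω : ι → W => f (ω i)) (Measure.pi fun _ : ι => P) t
        ≤ ∏ _i : ι, Real.exp (t ^ 2 * σ) :=
          Finset.prod_le_prod (fun i _ => mgf_nonneg) fun i _ => hone i
      _ = _ := by rw [Finset.prod_const, ← Real.exp_nat_mul]; simp
  have h := measure_ge_le_exp_mul_mgf a ht0 hint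
  rw [← ofReal_measureReal]
  refine ENNReal.ofReal_le_ofReal (h.trans ?_)
  rw [Real.exp_add]
  exact mul_le_mul_of_nonneg_left hmgf (Real.exp_nonneg _)

/-- A Bernstein inequality. The summands are bounded by `M` and have second moment at most `V * τ`,
and the deviation is of the order `√(ℓ n τ)`; the condition `ℓ ≤ n τ` says that the Gaussian part
of Bernstein's bound dominates. -/
theorem pi_abs_sum_sub_integral_ge_le {W ι : Type*} [MeasurableSpace W] [Fintype ι] {P : Measure W}
    [IsProbabilityMeasure P] {g : W → ℝ} (hg : Measurable g) {M V τ ℓ n : ℝ} (hM : 0 < M)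
    (hV : 0 ≤ V) (hgM : ∀ w, |g w| ≤ M) (h2 : ∫ w, g w ^ 2 ∂P ≤ V * τ) (hℓ : 0 ≤ ℓ)
    (hnτ : 0 < n * τ) (hℓn : ℓ ≤ n * τ) (hτ : 0 < τ) (hcard : (Fintype.card ι : ℝ) ≤ n) :
    (Measure.pi fun _ : ι => P)
        {ω | (2 * M + V / (2 * M)) * √(ℓ * (n * τ)) ≤ |∑ i, (g (ω i) - ∫ w, g w ∂P)|} ≤
      2 * ENNReal.ofReal (Real.exp (-ℓ)) := by
  have hgi : Integrable g P := Integrable.of_bound hg.aestronglyMeasurable M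
    (Eventually.of_forall hgM)
  have hg2 : Integrable (fun w => g w ^ 2) P :=
    Integrable.of_bound (hg.pow_const 2).aestronglyMeasurable (M ^ 2)
      (Eventually.of_forall fun w => by
        rw [Real.norm_eq_abs, abs_pow]
        exact pow_le_pow_left₀ (abs_nonneg _) (hgM w) 2)
  set e := ∫ w, g w ∂P with he
  have heM : |e| ≤ M := by
    have := norm_integral_le_of_norm_le_const (μ := P) (f := g) (C := M)
      (Eventually.of_forall hgM)
    simpa using this
  have hf : Measurable fun w => g w - e := hg.sub_const e
  have hfC : ∀ w, |g w - e| ≤ 2 * M := fun w => by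
    have := abs_sub (g w) e
    linarith [hgM w]
  have hf0 : ∫ w, (g w - e) ∂P = 0 := by
    rw [integral_sub hgi (integrable_const _)]; simp [he]
  have hf2 : ∫ w, (g w - e) ^ 2 ∂P ≤ V * τ := by
    have : ∫ w, (g w - e) ^ 2 ∂P = ∫ w, g w ^ 2 ∂P - e ^ 2 := by
      have h1 : ∀ w, (g w - e) ^ 2 = g w ^ 2 - 2 * e * g w + e ^ 2 := fun w => by ring
      simp_rw [h1]
      have h2i : Integrable (fun w => g w ^ 2 - 2 * e * g w) P := hg2.sub (hgi.const_mul _)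
      rw [integral_add h2i (integrable_const _),
        integral_sub hg2 (hgi.const_mul _), integral_const_mul, ← he]
      simp; ring
    rw [this]; nlinarith [sq_nonneg e]
  -- the optimal parameter of the Chernoff bound, up to a constant
  set t := √(ℓ / (n * τ)) / (2 * M) with ht
  have hr0 : 0 ≤ √(ℓ / (n * τ)) := Real.sqrt_nonneg _
  have ht0 : 0 ≤ t := by positivity
  have hr1 : √(ℓ / (n * τ)) ≤ 1 := by
    rw [Real.sqrt_le_one]; exact (div_le_one hnτ).2 hℓn
  have htC : t * (2 * M) ≤ 1 := by
    rw [ht, div_mul_cancel₀ _ (by positivity)]; exact hr1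
  set a := (2 * M + V / (2 * M)) * √(ℓ * (n * τ)) with ha
  have hrs : √(ℓ / (n * τ)) ^ 2 = ℓ / (n * τ) := Real.sq_sqrt (by positivity)
  have hrr : √(ℓ / (n * τ)) * √(ℓ * (n * τ)) = ℓ := by
    rw [← Real.sqrt_mul (by positivity),
      show ℓ / (n * τ) * (ℓ * (n * τ)) = ℓ * ℓ by
        rw [div_mul_eq_mul_div, mul_div_assoc, mul_div_cancel_right₀ _ hnτ.ne']]
    exact Real.sqrt_mul_self hℓ
  have hexp : -t * a + Fintype.card ι * (t ^ 2 * (V * τ)) ≤ -ℓ := by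
    have h1 : t * a = ℓ + V * ℓ / (4 * M ^ 2) := by
      rw [ht, ha]
      calc √(ℓ / (n * τ)) / (2 * M) * ((2 * M + V / (2 * M)) * √(ℓ * (n * τ)))
          = (√(ℓ / (n * τ)) * √(ℓ * (n * τ))) * ((2 * M + V / (2 * M)) / (2 * M)) := by ring
        _ = ℓ + V * ℓ / (4 * M ^ 2) := by rw [hrr]; field_simp; ring
    have h3 : (Fintype.card ι : ℝ) * (t ^ 2 * (V * τ)) ≤ V * ℓ / (4 * M ^ 2) := by
      calc (Fintype.card ι : ℝ) * (t ^ 2 * (V * τ)) ≤ n * (t ^ 2 * (V * τ)) := by gcongr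
        _ = V * ℓ / (4 * M ^ 2) := by
            rw [ht, div_pow, hrs]
            have : n ≠ 0 := by rintro rfl; simp at hnτ
            field_simp; ring
    linarith
  have hup : (Measure.pi fun _ : ι => P) {ω | a ≤ ∑ i, (g (ω i) - e)} ≤
      ENNReal.ofReal (Real.exp (-ℓ)) :=
    (pi_sum_ge_le_exp hf hfC hf0 hf2 ht0 htC).trans
      (ENNReal.ofReal_le_ofReal (Real.exp_le_exp.2 hexp))
  have hdown : (Measure.pi fun _ : ι => P) {ω | a ≤ ∑ i, -(g (ω i) - e)} ≤
      ENNReal.ofReal (Real.exp (-ℓ)) :=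
    (pi_sum_ge_le_exp (f := fun w => -(g w - e)) hf.neg (fun w => by rw [abs_neg]; exact hfC w)
      (by rw [integral_neg, hf0, neg_zero]) (by simpa only [neg_sq] using hf2) ht0 htC).trans
      (ENNReal.ofReal_le_ofReal (Real.exp_le_exp.2 hexp))
  calc (Measure.pi fun _ : ι => P) {ω | a ≤ |∑ i, (g (ω i) - e)|}
      ≤ (Measure.pi fun _ : ι => P)
          ({ω | a ≤ ∑ i, (g (ω i) - e)} ∪ {ω | a ≤ ∑ i, -(g (ω i) - e)}) := by
        refine measure_mono fun ω hω => ?_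
        simp only [Set.mem_ofPred_eq, Set.mem_union, Finset.sum_neg_distrib] at hω ⊢
        exact le_abs.1 hω
    _ ≤ _ := (measure_union_le _ _).trans (by rw [two_mul]; exact add_le_add hup hdown)

/-- A tail bound for sums over the sample with a parameter frozen passes, by Fubini, to the
leave-one-out sum in which the parameter is the excluded sample point. -/
theorem pi_leaveOneOut_le {W : Type*} [MeasurableSpace W] {P : Measure W} [IsProbabilityMeasure P]
    {n : ℕ} {G : W → W → ℝ} (hG : Measurable (Function.uncurry G)) {a : ℝ} {δ : ℝ≥0∞}
    (h : ∀ u, (Measure.pi fun _ : Fin n => P)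
      {ω | a ≤ |∑ j, (G u (ω j) - ∫ w, G u w ∂P)|} ≤ δ) (i : Fin (n + 1)) :
    (Measure.pi fun _ : Fin (n + 1) => P)
      {ω | a ≤ |∑ j ∈ Finset.univ.erase i, (G (ω i) (ω j) - ∫ w, G (ω i) w ∂P)|} ≤ δ := by
  have hmp := measurePreserving_piFinSuccAbove (fun _ : Fin (n + 1) => P) i
  have hI : Measurable fun u => ∫ w, G u w ∂P :=
    (hG.stronglyMeasurable.integral_prod_right).measurable
  set A : Set (W × (Fin n → W)) :=
    {x | a ≤ |∑ j, (G x.1 (x.2 j) - ∫ w, G x.1 w ∂P)|} with hA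
  have hAm : MeasurableSet A := by
    refine measurableSet_le measurable_const ?_
    refine (Finset.measurable_sum _ fun j _ => Measurable.sub ?_ (hI.comp measurable_fst)).abs
    exact hG.comp (measurable_fst.prodMk ((measurable_pi_apply j).comp measurable_snd))
  have hset : {ω : Fin (n + 1) → W | a ≤ |∑ j ∈ Finset.univ.erase i,
      (G (ω i) (ω j) - ∫ w, G (ω i) w ∂P)|} =
      (MeasurableEquiv.piFinSuccAbove (fun _ => W) i) ⁻¹' A := by
    ext ω
    have : ∑ j ∈ Finset.univ.erase i, (G (ω i) (ω j) - ∫ w, G (ω i) w ∂P) =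
        ∑ j : Fin n, (G (ω i) (ω (i.succAbove j)) - ∫ w, G (ω i) w ∂P) := by
      have h1 := Fin.sum_univ_succAbove (fun j => G (ω i) (ω j) - ∫ w, G (ω i) w ∂P) i
      have h2 := Finset.add_sum_erase Finset.univ
        (fun j => G (ω i) (ω j) - ∫ w, G (ω i) w ∂P) (Finset.mem_univ i)
      linarith
    simp only [Set.mem_ofPred_eq, Set.mem_preimage, hA, this]
    rfl
  rw [hset, hmp.measure_preimage hAm.nullMeasurableSet, Measure.prod_apply hAm]
  calc _ ≤ ∫⁻ _u : W, δ ∂P := lintegral_mono fun u => h u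
    _ = δ := by simp

/-! ### Integral probability metrics, finite nets and empirical measures -/

theorem IPM_le_IPM_add {E : Type*} [MeasurableSpace E] {V : Set (E → ℝ)} (hV : V.Nonempty)
    {P Q P' Q' : Measure E} {C a b : ℝ}
    (hC : ∀ v ∈ V, |∫ z, v z ∂P' - ∫ z, v z ∂Q'| ≤ C)
    (ha : ∀ v ∈ V, |∫ z, v z ∂P - ∫ z, v z ∂P'| ≤ a)
    (hb : ∀ v ∈ V, |∫ z, v z ∂Q - ∫ z, v z ∂Q'| ≤ b) :
    IPM V P Q ≤ IPM V P' Q' + (a + b) := by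
  have : Nonempty V := hV.to_subtype
  refine ciSup_le fun v => ?_
  have h1 : |∫ z, (v : E → ℝ) z ∂P' - ∫ z, (v : E → ℝ) z ∂Q'| ≤ IPM V P' Q' :=
    le_ciSup (f := fun v : V => |∫ z, (v : E → ℝ) z ∂P' - ∫ z, (v : E → ℝ) z ∂Q'|)
      ⟨C, by rintro _ ⟨w, rfl⟩; exact hC w w.2⟩ v
  have h2 := ha v v.2
  have h3 := hb v v.2
  rw [abs_le] at *
  constructor <;> linarith [h1.1, h1.2, h2.1, h2.2, h3.1, h3.2]

theorem abs_IPM_sub_IPM_le {E : Type*} [MeasurableSpace E] {V : Set (E → ℝ)} (hV : V.Nonempty)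
    {P Q P' Q' : Measure E} {C a b : ℝ}
    (hC : ∀ v ∈ V, |∫ z, v z ∂P - ∫ z, v z ∂Q| ≤ C)
    (hC' : ∀ v ∈ V, |∫ z, v z ∂P' - ∫ z, v z ∂Q'| ≤ C)
    (ha : ∀ v ∈ V, |∫ z, v z ∂P - ∫ z, v z ∂P'| ≤ a)
    (hb : ∀ v ∈ V, |∫ z, v z ∂Q - ∫ z, v z ∂Q'| ≤ b) :
    |IPM V P Q - IPM V P' Q'| ≤ a + b := by
  have h1 := IPM_le_IPM_add hV hC' ha hb
  have h2 := IPM_le_IPM_add hV hC (fun v hv => by rw [abs_sub_comm]; exact ha v hv)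
    (fun v hv => by rw [abs_sub_comm]; exact hb v hv)
  rw [abs_le]; constructor <;> linarith

theorem IPM_nonneg {E : Type*} [MeasurableSpace E] (V : Set (E → ℝ)) (P Q : Measure E) :
    0 ≤ IPM V P Q := Real.iSup_nonneg fun _ => abs_nonneg _

theorem IPM_le {E : Type*} [MeasurableSpace E] {V : Set (E → ℝ)} (hV : V.Nonempty)
    {P Q : Measure E} {C : ℝ} (hC : ∀ v ∈ V, |∫ z, v z ∂P - ∫ z, v z ∂Q| ≤ C) :
    IPM V P Q ≤ C := by
  have : Nonempty V := hV.to_subtype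
  exact ciSup_le fun v => hC v v.2

theorem abs_integral_le_of_ae_mem {E : Type*} [MeasurableSpace E] {Q : Measure E}
    [IsProbabilityMeasure Q] {A : Set E} (hA : ∀ᵐ z ∂Q, z ∈ A) {v : E → ℝ} {ε : ℝ}
    (h : ∀ z ∈ A, |v z| ≤ ε) : |∫ z, v z ∂Q| ≤ ε := by
  have := norm_integral_le_of_norm_le_const (μ := Q) (f := v) (C := ε)
    (hA.mono fun z hz => h z hz)
  simpa using this

theorem abs_integral_sub_integral_le_of_ae_mem {E : Type*} [MeasurableSpace E] {Q : Measure E}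
    [IsProbabilityMeasure Q] {A : Set E} (hA : ∀ᵐ z ∂Q, z ∈ A) {v w : E → ℝ} {C ε : ℝ}
    (hv : Measurable v) (hw : Measurable w) (hvC : ∀ z ∈ A, |v z| ≤ C) (hwC : ∀ z ∈ A, |w z| ≤ C)
    (h : ∀ z ∈ A, |v z - w z| ≤ ε) : |∫ z, v z ∂Q - ∫ z, w z ∂Q| ≤ ε := by
  rw [← integral_sub (Integrable.of_bound hv.aestronglyMeasurable C (hA.mono fun z hz => hvC z hz))
    (Integrable.of_bound hw.aestronglyMeasurable C (hA.mono fun z hz => hwC z hz))]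
  exact abs_integral_le_of_ae_mem hA h

/-- A class with finite external covering number at scale `ε` has a net of the same size inside
itself at scale `2 * ε`. -/
theorem exists_finset_net_of_supCoveringNumber_ne_top {E : Type*} {ε : ℝ} (hε : 0 ≤ ε) {A : Set E}
    {V : Set (E → ℝ)} (h : supCoveringNumber ε A V ≠ ⊤) :
    ∃ V₀ : Finset (E → ℝ), (∀ v ∈ V₀, v ∈ V) ∧ V₀.card ≤ (supCoveringNumber ε A V).toNat ∧
      ∀ v ∈ V, ∃ w ∈ V₀, ∀ z ∈ A, |v z - w z| ≤ 2 * ε := by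
  classical
  set r : (E → ℝ) → UniformFun A ℝ := fun v => UniformFun.ofFun (fun z : A => v z) with hr
  have hle := Metric.coveringNumber_two_mul_le_externalCoveringNumber ε.toNNReal (r '' V)
  have hne : Metric.coveringNumber (2 * ε.toNNReal) (r '' V) ≠ ⊤ := ne_top_of_le_ne_top h hle
  obtain ⟨C, hCsub, hCfin, hCcov, hCcard⟩ := Metric.exists_set_encard_eq_coveringNumber hne
  choose! f hfV hf using fun u (hu : u ∈ C) => hCsub hu
  refine ⟨hCfin.toFinset.image f, ?_, ?_, ?_⟩
  · intro v hv
    obtain ⟨u, hu, rfl⟩ := Finset.mem_image.1 hv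
    exact hfV u (hCfin.mem_toFinset.1 hu)
  · refine Finset.card_image_le.trans ?_
    have h1 : (hCfin.toFinset.card : ℕ∞) ≤ supCoveringNumber ε A V := by
      rw [← hCfin.encard_eq_coe_toFinset_card, hCcard]; exact hle
    exact ENat.toNat_le_toNat h1 h
  · intro v hv
    obtain ⟨u, hu, huv⟩ := hCcov (Set.mem_image_of_mem r hv)
    refine ⟨f u, Finset.mem_image_of_mem f (hCfin.mem_toFinset.2 hu), fun z hz => ?_⟩
    have hd : edist (r v) (r (f u)) ≤ ((2 * ε.toNNReal : ℝ≥0) : ℝ≥0∞) := by rw [hf u hu]; exact huv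
    rw [UniformFun.edist_def] at hd
    have h1 := (le_iSup (fun x : A => edist (UniformFun.toFun (r v) x)
      (UniformFun.toFun (r (f u)) x)) ⟨z, hz⟩).trans hd
    have h2 : edist (v z) (f u z) ≤ ((2 * ε.toNNReal : ℝ≥0) : ℝ≥0∞) := h1
    rw [edist_nndist, ENNReal.coe_le_coe] at h2
    have h3 : dist (v z) (f u z) ≤ ((2 * ε.toNNReal : ℝ≥0) : ℝ) := by exact_mod_cast h2
    rw [Real.dist_eq] at h3
    simpa [Real.coe_toNNReal _ hε] using h3

/-- For a class that is totally bounded in the sup norm, the IPM between a kernel and a fixed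
measure is a uniform limit of suprema over finite classes, hence almost everywhere measurable. -/
theorem aemeasurable_IPM_kernel {E : Type*} [MeasurableSpace E] {V : Set (E → ℝ)}
    (hV : V.Nonempty) {A : Set E} (hVm : ∀ v ∈ V, Measurable v ∧ ∀ z ∈ A, |v z| ≤ 1)
    (κ : Kernel ℝ E) [IsMarkovKernel κ] (Q : Measure E) [IsProbabilityMeasure Q]
    {ν : Measure ℝ} (hκ : ∀ᵐ s ∂ν, ∀ᵐ z ∂κ s, z ∈ A) (hQ : ∀ᵐ z ∂Q, z ∈ A)
    (hnet : ∀ ε > 0, ∃ V₀ : Finset (E → ℝ), (∀ v ∈ V₀, v ∈ V) ∧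
      ∀ v ∈ V, ∃ w ∈ V₀, ∀ z ∈ A, |v z - w z| ≤ ε) :
    AEMeasurable (fun s => IPM V (κ s) Q) ν := by
  have hpos : ∀ j : ℕ, (0 : ℝ) < 1 / ((j : ℝ) + 1) := fun j => by positivity
  choose V₀ hsub hcov using fun j : ℕ => hnet _ (hpos j)
  refine aemeasurable_of_tendsto_metrizable_ae (atTop : Filter ℕ)
    (f := fun j s => IPM (V₀ j : Set (E → ℝ)) (κ s) Q) (fun j => ?_) ?_
  · refine Measurable.aemeasurable (Measurable.iSup fun v => ?_)
    have hm : Measurable (v : E → ℝ) := (hVm _ (hsub j _ v.2)).1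
    have h1 : Measurable fun s => ∫ z, (v : E → ℝ) z ∂κ s :=
      (hm.stronglyMeasurable.integral_kernel (κ := κ)).measurable
    exact (h1.sub_const _).abs
  · filter_upwards [hκ] with s hs
    rw [tendsto_iff_dist_tendsto_zero]
    have hlim : Tendsto (fun j : ℕ => 2 * (1 / ((j : ℝ) + 1))) atTop (𝓝 0) := by
      simpa using tendsto_one_div_add_atTop_nhds_zero_nat.const_mul (2 : ℝ)
    refine squeeze_zero (fun _ => dist_nonneg) (fun j => ?_) hlim
    have hbd : ∀ v ∈ V, |∫ z, v z ∂κ s - ∫ z, v z ∂Q| ≤ 2 := fun v hv => by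
      have h1 := abs_integral_le_of_ae_mem hs (hVm v hv).2
      have h2 := abs_integral_le_of_ae_mem hQ (hVm v hv).2
      have := abs_sub (∫ z, v z ∂κ s) (∫ z, v z ∂Q)
      linarith
    have hne : (V₀ j : Set (E → ℝ)).Nonempty := by
      obtain ⟨v, hv⟩ := hV
      obtain ⟨w, hw, -⟩ := hcov j v hv
      exact ⟨w, hw⟩
    have hle : IPM (V₀ j : Set (E → ℝ)) (κ s) Q ≤ IPM V (κ s) Q := by
      have : Nonempty (V₀ j : Set (E → ℝ)) := hne.to_subtype
      refine ciSup_le fun v => ?_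
      exact le_ciSup (f := fun v : V => |∫ z, (v : E → ℝ) z ∂κ s - ∫ z, (v : E → ℝ) z ∂Q|)
        ⟨2, by rintro _ ⟨w, rfl⟩; exact hbd w w.2⟩ ⟨v, hsub j _ v.2⟩
    have hge : IPM V (κ s) Q ≤
        IPM (V₀ j : Set (E → ℝ)) (κ s) Q + 2 * (1 / ((j : ℝ) + 1)) := by
      refine IPM_le hV fun v hv => ?_
      obtain ⟨w, hw, hvw⟩ := hcov j v hv
      have hwV := hVm w (hsub j w hw)
      have h1 := abs_integral_sub_integral_le_of_ae_mem hs (hVm v hv).1 hwV.1 (hVm v hv).2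
        hwV.2 hvw
      have h2 := abs_integral_sub_integral_le_of_ae_mem hQ (hVm v hv).1 hwV.1 (hVm v hv).2
        hwV.2 hvw
      have h3 : |∫ z, w z ∂κ s - ∫ z, w z ∂Q| ≤ IPM (V₀ j : Set (E → ℝ)) (κ s) Q :=
        le_ciSup (f := fun v : (V₀ j : Set (E → ℝ)) =>
            |∫ z, (v : E → ℝ) z ∂κ s - ∫ z, (v : E → ℝ) z ∂Q|)
          ⟨2, by rintro _ ⟨w, rfl⟩; exact hbd w (hsub j _ w.2)⟩ ⟨w, hw⟩
      rw [abs_le] at *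
      constructor <;> linarith [h1.1, h1.2, h2.1, h2.2, h3.1, h3.2]
    rw [Real.dist_eq, abs_le]
    constructor <;> linarith

theorem integral_sum_dirac {E ι : Type*} [MeasurableSpace E] (s : Finset ι) {c : ι → ℝ}
    (hc : ∀ j ∈ s, 0 ≤ c j) (Z : ι → E) {v : E → ℝ} (hv : Measurable v) :
    ∫ z, v z ∂(∑ j ∈ s, ENNReal.ofReal (c j) • Measure.dirac (Z j)) = ∑ j ∈ s, c j * v (Z j) := by
  rw [integral_finsetSum_measure]
  · refine Finset.sum_congr rfl fun j hj => ?_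
    rw [integral_smul_measure, integral_dirac' _ _ hv.stronglyMeasurable,
      ENNReal.toReal_ofReal (hc j hj), smul_eq_mul]
  · intro j _
    refine Integrable.smul_measure ?_ ENNReal.ofReal_ne_top
    exact (integrable_dirac' hv.stronglyMeasurable (by simp))

theorem integral_condEmpirical {E : Type*} [MeasurableSpace E] {k : ℝ → ℝ} (hk : ∀ t, 0 ≤ k t)
    (γ : ℝ) {n : ℕ} (Z : Fin n → E) (S : Fin n → ℝ) (i : Fin n) {v : E → ℝ} (hv : Measurable v) :
    ∫ z, v z ∂condEmpirical k γ Z S i =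
      (∑ j ∈ Finset.univ.erase i, k ((S j - S i) / γ) * v (Z j)) /
        ∑ j ∈ Finset.univ.erase i, k ((S j - S i) / γ) := by
  rw [condEmpirical, integral_sum_dirac _ _ Z hv, Finset.sum_div]
  · refine Finset.sum_congr rfl fun j _ => ?_
    simp only [kernelWeight, smoothingKernel]; ring
  · intro j _
    exact div_nonneg (hk _) (Finset.sum_nonneg fun l _ => hk _)

theorem integral_margEmpirical {E : Type*} [MeasurableSpace E] {n : ℕ} (hn : 1 ≤ n)
    (Z : Fin n → E) (i : Fin n) {v : E → ℝ} (hv : Measurable v) :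
    ∫ z, v z ∂margEmpirical Z i =
      (∑ j ∈ Finset.univ.erase i, v (Z j)) / ((n : ℝ) - 1) := by
  have h1 : (1 : ℝ) ≤ n := by exact_mod_cast hn
  rw [margEmpirical, integral_sum_dirac _ _ Z hv, Finset.sum_div]
  · exact Finset.sum_congr rfl fun j _ => by ring
  · intro j _
    exact div_nonneg zero_le_one (by linarith)

theorem abs_weighted_mean_le {ι : Type*} (s : Finset ι) {c f : ι → ℝ} (hc : ∀ j ∈ s, 0 ≤ c j)
    {C : ℝ} (hC : 0 ≤ C) (hf : ∀ j ∈ s, |f j| ≤ C) :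
    |(∑ j ∈ s, c j * f j) / ∑ j ∈ s, c j| ≤ C := by
  have h0 : 0 ≤ ∑ j ∈ s, c j := Finset.sum_nonneg hc
  rw [abs_div, abs_of_nonneg h0]
  refine div_le_of_le_mul₀ h0 hC ?_
  calc |∑ j ∈ s, c j * f j| ≤ ∑ j ∈ s, |c j * f j| := Finset.abs_sum_le_sum_abs _ _
    _ ≤ ∑ j ∈ s, C * c j := Finset.sum_le_sum fun j hj => by
        rw [abs_mul, abs_of_nonneg (hc j hj), mul_comm]
        exact mul_le_mul_of_nonneg_right (hf j hj) (hc j hj)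
    _ = C * ∑ j ∈ s, c j := by rw [Finset.mul_sum]

theorem abs_integral_condEmpirical_le {E : Type*} [MeasurableSpace E] {k : ℝ → ℝ}
    (hk : IsKernelProfile k) (γ : ℝ) {n : ℕ}
    (Z : Fin n → E) (S : Fin n → ℝ) (i : Fin n) {v : E → ℝ} (hv : Measurable v) {C : ℝ}
    (hC : 0 ≤ C) (hvZ : ∀ j, |v (Z j)| ≤ C) : |∫ z, v z ∂condEmpirical k γ Z S i| ≤ C := by
  rw [integral_condEmpirical hk.nonneg γ Z S i hv]
  exact abs_weighted_mean_le _ (fun j _ => hk.nonneg _) hC fun j _ => hvZ j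

theorem abs_integral_margEmpirical_le {E : Type*} [MeasurableSpace E] {N : ℕ}
    (Z : Fin (N + 1) → E) (i : Fin (N + 1)) {v : E → ℝ}
    (hv : Measurable v) {C : ℝ} (hC : 0 ≤ C) (hvZ : ∀ j, |v (Z j)| ≤ C) :
    |∫ z, v z ∂margEmpirical Z i| ≤ C := by
  rw [integral_margEmpirical (by omega) Z i hv]
  have h := abs_weighted_mean_le (Finset.univ.erase i) (c := fun _ => 1) (f := fun j => v (Z j))
    (fun _ _ => zero_le_one) hC fun j _ => hvZ j
  simpa [Finset.card_erase_of_mem] using h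

theorem abs_integral_condEmpirical_sub_le {E : Type*} [MeasurableSpace E] {k : ℝ → ℝ}
    (hk : IsKernelProfile k) (γ : ℝ) {n : ℕ}
    (Z : Fin n → E) (S : Fin n → ℝ) (i : Fin n) {v w : E → ℝ} (hv : Measurable v)
    (hw : Measurable w) {η : ℝ} (hη : 0 ≤ η) (hvw : ∀ j, |v (Z j) - w (Z j)| ≤ η) :
    |∫ z, v z ∂condEmpirical k γ Z S i - ∫ z, w z ∂condEmpirical k γ Z S i| ≤ η := by
  have h := abs_integral_condEmpirical_le hk γ Z S i (hv.sub hw) hη hvw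
  rw [integral_condEmpirical hk.nonneg γ Z S i (hv.sub hw)] at h
  rw [integral_condEmpirical hk.nonneg γ Z S i hv, integral_condEmpirical hk.nonneg γ Z S i hw,
    ← sub_div, ← Finset.sum_sub_distrib]
  simpa only [Pi.sub_apply, mul_sub] using h

theorem abs_integral_margEmpirical_sub_le {E : Type*} [MeasurableSpace E] {N : ℕ}
    (Z : Fin (N + 1) → E) (i : Fin (N + 1))
    {v w : E → ℝ} (hv : Measurable v) (hw : Measurable w) {η : ℝ} (hη : 0 ≤ η)
    (hvw : ∀ j, |v (Z j) - w (Z j)| ≤ η) :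
    |∫ z, v z ∂margEmpirical Z i - ∫ z, w z ∂margEmpirical Z i| ≤ η := by
  have h := abs_integral_margEmpirical_le Z i (hv.sub hw) hη hvw
  rw [integral_margEmpirical (by omega) Z i (hv.sub hw)] at h
  rw [integral_margEmpirical (by omega) Z i hv, integral_margEmpirical (by omega) Z i hw,
    ← sub_div, ← Finset.sum_sub_distrib]
  simpa only [Pi.sub_apply] using h

/-! ### Taylor expansion of a smooth density in mean -/

/-- The upper right-hand difference quotient along the steps `1 / (j + 1)` in the second variable.
It equals the partial derivative wherever that exists and is always jointly measurable. -/
noncomputable def rightQuotientLimsup {X : Type*} (f : X × ℝ → ℝ) (w : X × ℝ) : ℝ :=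
  limsup (fun j : ℕ => ((j : ℝ) + 1) * (f (w.1, w.2 + 1 / ((j : ℝ) + 1)) - f w)) atTop

theorem measurable_rightQuotientLimsup {X : Type*} [MeasurableSpace X] {f : X × ℝ → ℝ}
    (hf : Measurable f) : Measurable (rightQuotientLimsup f) := by
  refine Measurable.limsup fun j => ?_
  refine (Measurable.sub (hf.comp ?_) hf).const_mul _
  exact measurable_fst.prodMk (measurable_snd.add_const _)

theorem rightQuotientLimsup_eq {X : Type*} {f : X × ℝ → ℝ} {x : X} {s d : ℝ}
    (h : HasDerivAt (fun t => f (x, t)) d s) : rightQuotientLimsup f (x, s) = d := by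
  refine Tendsto.limsup_eq ?_
  have h1 := hasDerivAt_iff_tendsto_slope_zero.1 h
  have h2 : Tendsto (fun j : ℕ => 1 / ((j : ℝ) + 1)) atTop (𝓝[≠] 0) := by
    refine tendsto_nhdsWithin_iff.2 ⟨tendsto_one_div_add_atTop_nhds_zero_nat, ?_⟩
    exact Eventually.of_forall fun j => by
      have : (0 : ℝ) < 1 / ((j : ℝ) + 1) := by positivity
      exact this.ne'
  refine (h1.comp h2).congr fun j => ?_
  simp [smul_eq_mul]

/-- First-order Taylor estimate with the remainder controlled by the integral of the second
derivative. -/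
theorem enorm_sub_sub_mul_le_lintegral {I : Set ℝ} {f g₁ g₂ : ℝ → ℝ} (hI : I.OrdConnected)
    (h1 : ∀ s ∈ I, HasDerivAt f (g₁ s) s) (h2 : ∀ s ∈ I, HasDerivAt g₁ (g₂ s) s)
    {g : ℝ → ℝ} (hg : Measurable g) (hgg : ∀ s ∈ I, g s = g₂ s) {B : ℝ}
    (hB : ∀ s ∈ I, |g₂ s| ≤ B) {s t : ℝ} (hs : s ∈ I) (ht : t ∈ I) :
    ‖f t - f s - (t - s) * g₁ s‖ₑ ≤ ‖t - s‖ₑ * ∫⁻ r in Set.uIcc s t, ‖g r‖ₑ := by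
  have hsub : Set.uIcc s t ⊆ I := hI.uIcc_subset hs ht
  have hint : IntegrableOn g (Set.uIcc s t) := by
    refine Measure.integrableOn_of_bounded (M := B) isCompact_uIcc.measure_lt_top.ne
      hg.aestronglyMeasurable ?_
    filter_upwards [ae_restrict_mem measurableSet_uIcc] with r hr
    rw [hgg r (hsub hr)]; exact hB r (hsub hr)
  have hincr : ∀ u ∈ Set.uIcc s t, ‖g₁ u - g₁ s‖ ≤ ∫ r in Set.uIcc s t, ‖g r‖ := by
    intro u hu
    have hsu : Set.uIcc s u ⊆ Set.uIcc s t := Set.uIcc_subset_uIcc_left hu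
    have hi : IntervalIntegrable g volume s u :=
      (hint.mono_set hsu).intervalIntegrable
    have := intervalIntegral.integral_eq_sub_of_hasDerivAt (a := s) (b := u) (f := g₁) (f' := g)
      (fun r hr => by rw [hgg r (hsub (hsu hr))]; exact h2 r (hsub (hsu hr))) hi
    rw [← this]
    refine (intervalIntegral.norm_integral_le_integral_norm_uIoc).trans ?_
    exact setIntegral_mono_set hint.norm (Eventually.of_forall fun r => norm_nonneg _)
      ((Set.uIoc_subset_uIcc.trans hsu).eventuallyLE)
  have hmv := Convex.norm_image_sub_le_of_norm_hasDerivWithin_le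
    (f := fun u => f u - (u - s) * g₁ s) (f' := fun u => g₁ u - g₁ s)
    (C := ∫ r in Set.uIcc s t, ‖g r‖) (s := Set.uIcc s t) (x := s) (y := t)
    (fun u hu => by
      have h3 := (h1 u (hsub hu)).sub (((hasDerivAt_id u).sub_const s).mul_const (g₁ s))
      have h4 : HasDerivAt (fun u => f u - (u - s) * g₁ s) (g₁ u - g₁ s) u := by
        rw [one_mul] at h3; exact h3
      exact h4.hasDerivWithinAt) hincr (convex_uIcc s t) Set.left_mem_uIcc Set.right_mem_uIcc
  have hmv' : ‖f t - f s - (t - s) * g₁ s‖ ≤ (∫ r in Set.uIcc s t, ‖g r‖) * ‖t - s‖ := by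
    have h5 : f t - f s - (t - s) * g₁ s =
        f t - (t - s) * g₁ s - (f s - (s - s) * g₁ s) := by ring
    rw [h5]; exact hmv
  calc ‖f t - f s - (t - s) * g₁ s‖ₑ
      = ENNReal.ofReal ‖f t - f s - (t - s) * g₁ s‖ := (ofReal_norm _).symm
    _ ≤ ENNReal.ofReal ((∫ r in Set.uIcc s t, ‖g r‖) * ‖t - s‖) := ENNReal.ofReal_le_ofReal hmv'
    _ = ‖t - s‖ₑ * ∫⁻ r in Set.uIcc s t, ‖g r‖ₑ := by
        rw [ENNReal.ofReal_mul (integral_nonneg fun r => norm_nonneg _),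
          ofReal_integral_norm_eq_lintegral_enorm hint, ofReal_norm, mul_comm]

/-- Taylor's formula in `L¹`: the mean of the second derivative being bounded, the mean of the
remainder is quadratic. -/
theorem lintegral_taylor_le {X : Type*} [MeasurableSpace X] {μX : Measure X} [SigmaFinite μX]
    {I : Set ℝ} (hIo : IsOpen I) (hI : I.OrdConnected) {p g₁ g₂ : X → ℝ → ℝ}
    (hp : Measurable (Function.uncurry p))
    (h1 : ∀ x, ∀ s ∈ I, HasDerivAt (p x) (g₁ x s) s)
    (h2 : ∀ x, ∀ s ∈ I, HasDerivAt (g₁ x) (g₂ x s) s)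
    (hb : ∀ x, ∃ B : ℝ, ∀ s ∈ I, |g₂ x s| ≤ B) {B : ℝ≥0}
    (hB : ∀ s ∈ I, ∫⁻ x, ‖g₂ x s‖ₑ ∂μX ≤ B) {s t : ℝ} (hs : s ∈ I) (ht : t ∈ I) :
    ∫⁻ x, ‖p x t - p x s - (t - s) * g₁ x s‖ₑ ∂μX ≤ ENNReal.ofReal (B * (t - s) ^ 2) := by
  set q₁ := rightQuotientLimsup (Function.uncurry p) with hq₁
  set q₂ := rightQuotientLimsup q₁ with hq₂
  have hq₂m : Measurable q₂ :=
    measurable_rightQuotientLimsup (measurable_rightQuotientLimsup hp)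
  have e1 : ∀ x, ∀ r ∈ I, q₁ (x, r) = g₁ x r := fun x r hr => rightQuotientLimsup_eq (h1 x r hr)
  have e2 : ∀ x, ∀ r ∈ I, q₂ (x, r) = g₂ x r := fun x r hr => by
    refine rightQuotientLimsup_eq ((h2 x r hr).congr_of_eventuallyEq ?_)
    filter_upwards [hIo.mem_nhds hr] with u hu using e1 x u hu
  have hsub : Set.uIcc s t ⊆ I := hI.uIcc_subset hs ht
  calc ∫⁻ x, ‖p x t - p x s - (t - s) * g₁ x s‖ₑ ∂μX
      ≤ ∫⁻ x, ‖t - s‖ₑ * (∫⁻ r in Set.uIcc s t, ‖q₂ (x, r)‖ₑ) ∂μX :=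
        lintegral_mono fun x => by
          obtain ⟨Bx, hBx⟩ := hb x
          exact enorm_sub_sub_mul_le_lintegral hI (h1 x) (h2 x)
            (hq₂m.comp measurable_prodMk_left) (e2 x) hBx hs ht
    _ = ‖t - s‖ₑ * ∫⁻ r in Set.uIcc s t, ∫⁻ x, ‖q₂ (x, r)‖ₑ ∂μX := by
        rw [lintegral_const_mul' _ _ enorm_ne_top, lintegral_lintegral_swap]
        exact hq₂m.enorm.aemeasurable
    _ ≤ ‖t - s‖ₑ * ∫⁻ _r in Set.uIcc s t, (B : ℝ≥0∞) := by
        refine mul_le_mul_right (setLIntegral_mono measurable_const fun r hr => ?_) _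
        refine le_trans (le_of_eq ?_) (hB r (hsub hr))
        exact lintegral_congr fun x => by rw [e2 x r (hsub hr)]
    _ = ENNReal.ofReal (B * (t - s) ^ 2) := by
        rw [setLIntegral_const, Set.uIcc, Real.volume_Icc, max_sub_min_eq_abs,
          ← ofReal_norm, Real.norm_eq_abs, ← ENNReal.ofReal_coe_nnreal,
          ← ENNReal.ofReal_mul B.coe_nonneg, ← ENNReal.ofReal_mul (abs_nonneg _), ← sq_abs]
        congr 1; ring

theorem Set.OrdConnected.volume_diff_interior {𝒮 : Set ℝ} (h𝒮 : 𝒮.OrdConnected) :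
    volume (𝒮 \ interior 𝒮) = 0 := by
  have h := h𝒮.convex.addHaar_frontier (μ := volume)
  refine measure_mono_null (fun x hx => ?_) h
  exact ⟨subset_closure hx.1, hx.2⟩

theorem Set.OrdConnected.ae_mem_interior {𝒮 : Set ℝ} (h𝒮 : 𝒮.OrdConnected) :
    ∀ᵐ s ∂(volume.restrict 𝒮), s ∈ interior 𝒮 := by
  rw [ae_restrict_iff' h𝒮.measurableSet]
  have h := h𝒮.volume_diff_interior
  rw [measure_eq_zero_iff_ae_notMem] at h
  filter_upwards [h] with s hs hsS
  by_contra hcon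
  exact hs ⟨hsS, hcon⟩

/-! ### The weighted marginal densities -/

/-- `m w` is a density on `𝒮` of the signed measure `A ↦ ∫ 1_A(s) w(x) dP(x, s)`, for every
measurable weight `w` with `|w| ≤ 1`; it is dominated by the density `m 1` of the second marginal,
which lies between `L` and `U`, and it has first-order Taylor expansions with slope at most `B₁`
and quadratic remainder. The pointwise properties are asked for almost everywhere only. -/
structure IsSmoothDisintegration {X : Type*} [MeasurableSpace X] (P : Measure (X × ℝ)) (𝒮 : Set ℝ)
    (m : (X → ℝ) → ℝ → ℝ) (L U B B₁ : ℝ) : Prop where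
  L_pos : 0 < L
  U_pos : 0 < U
  B_nonneg : 0 ≤ B
  B₁_nonneg : 0 ≤ B₁
  measurable : ∀ w : X → ℝ, Measurable w → Measurable (m w)
  integral_eq : ∀ w : X → ℝ, Measurable w → (∀ x, |w x| ≤ 1) → ∀ φ : ℝ → ℝ, Measurable φ →
    (∃ C, ∀ s, |φ s| ≤ C) → ∫ z, φ z.2 * w z.1 ∂P = ∫ s in 𝒮, φ s * m w s
  one_mem : ∀ᵐ s ∂(volume.restrict 𝒮), L ≤ m (fun _ => 1) s ∧ m (fun _ => 1) s ≤ U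
  abs_le : ∀ w : X → ℝ, Measurable w → (∀ x, |w x| ≤ 1) →
    ∀ᵐ s ∂(volume.restrict 𝒮), |m w s| ≤ m (fun _ => 1) s
  taylor : ∀ w : X → ℝ, Measurable w → (∀ x, |w x| ≤ 1) →
    ∀ᵐ s ∂(volume.restrict 𝒮), ∃ D : ℝ, |D| ≤ B₁ ∧
      ∀ᵐ t ∂(volume.restrict 𝒮), |m w t - m w s - (t - s) * D| ≤ B * (t - s) ^ 2

theorem map_snd_withDensity_prod {X : Type*} [MeasurableSpace X] {μX : Measure X} [SigmaFinite μX]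
    {ν : Measure ℝ} [SigmaFinite ν] {f : X × ℝ → ℝ≥0∞} (hf : Measurable f) :
    ((μX.prod ν).withDensity f).map Prod.snd = ν.withDensity fun s => ∫⁻ x, f (x, s) ∂μX := by
  ext A hA
  rw [Measure.map_apply measurable_snd hA, withDensity_apply _ (measurable_snd hA),
    withDensity_apply _ hA, ← lintegral_indicator (measurable_snd hA),
    lintegral_prod_symm _ ((hf.indicator (measurable_snd hA)).aemeasurable),
    ← lintegral_indicator hA]
  refine lintegral_congr fun s => ?_
  by_cases hs : s ∈ A
  · simp [hs, Set.indicator]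
  · simp [hs, Set.indicator]

theorem volume_le_of_withDensity {𝒮 : Set ℝ} (h𝒮 : MeasurableSet 𝒮) {q : ℝ → ℝ}
    (hq1 : ∫⁻ s in 𝒮, ENNReal.ofReal (q s) ≤ 1) {L : ℝ} (hL : 0 < L) (hLq : ∀ s ∈ 𝒮, L < q s) :
    volume 𝒮 ≤ ENNReal.ofReal (1 / L) := by
  have h1 : ENNReal.ofReal L * volume 𝒮 ≤ 1 := by
    rw [← setLIntegral_const]
    refine le_trans (lintegral_mono_ae ?_) hq1
    filter_upwards [ae_restrict_mem h𝒮] with s hs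
    exact ENNReal.ofReal_le_ofReal (hLq s hs).le
  rw [one_div, ENNReal.ofReal_inv_of_pos hL]
  rw [ENNReal.le_inv_iff_mul_le, mul_comm]
  exact h1

theorem Set.OrdConnected.abs_sub_le_of_volume_le {𝒮 : Set ℝ} (h𝒮 : 𝒮.OrdConnected) {D : ℝ}
    (hD : 0 ≤ D) (h : volume 𝒮 ≤ ENNReal.ofReal D) {s t : ℝ} (hs : s ∈ 𝒮) (ht : t ∈ 𝒮) :
    |t - s| ≤ D := by
  have h1 : volume (Set.uIcc s t) ≤ ENNReal.ofReal D :=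
    (measure_mono (h𝒮.uIcc_subset hs ht)).trans h
  rw [Set.uIcc, Real.volume_Icc, max_sub_min_eq_abs] at h1
  exact (ENNReal.ofReal_le_ofReal_iff hD).1 h1

theorem Set.OrdConnected.exists_Icc_subset_interior {𝒮 : Set ℝ} (h𝒮 : 𝒮.OrdConnected)
    (h : volume 𝒮 ≠ 0) : ∃ a b : ℝ, a < b ∧ Set.Icc a b ⊆ interior 𝒮 := by
  have hne : (interior 𝒮).Nonempty := by
    by_contra hcon
    rw [Set.not_nonempty_iff_eq_empty] at hcon
    have := h𝒮.volume_diff_interior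
    rw [hcon, Set.sdiff_empty] at this
    exact h this
  obtain ⟨c, hc⟩ := hne
  obtain ⟨ε, hε, hball⟩ := Metric.isOpen_iff.1 isOpen_interior c hc
  refine ⟨c, c + ε / 2, by linarith, fun x hx => hball ?_⟩
  rw [Metric.mem_ball, Real.dist_eq, abs_of_nonneg (by linarith [hx.1])]
  linarith [hx.2]

/-- The slope in a Taylor estimate in mean is integrable at a point where the density is, with the
bound obtained by comparing with a second point at distance at least `δ`. -/
theorem lintegral_slope_le {X : Type*} [MeasurableSpace X] {μX : Measure X} {ps pt g : X → ℝ}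
    (hps : Measurable ps) (hpt : Measurable pt) {U B δ D s t : ℝ}
    (hs : ∫⁻ x, ‖ps x‖ₑ ∂μX ≤ ENNReal.ofReal U) (ht : ∫⁻ x, ‖pt x‖ₑ ∂μX ≤ ENNReal.ofReal U)
    (hU : 0 ≤ U) (hB : 0 ≤ B) (hδ : 0 < δ) (hδt : δ ≤ |t - s|) (hD : |t - s| ≤ D)
    (h : ∫⁻ x, ‖pt x - ps x - (t - s) * g x‖ₑ ∂μX ≤ ENNReal.ofReal (B * (t - s) ^ 2)) :
    ∫⁻ x, ‖g x‖ₑ ∂μX ≤ ENNReal.ofReal ((2 * U + B * D ^ 2) / δ) := by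
  have hpos : 0 < |t - s| := hδ.trans_le hδt
  have h1 : ‖t - s‖ₑ * ∫⁻ x, ‖g x‖ₑ ∂μX ≤ ENNReal.ofReal (2 * U + B * D ^ 2) := by
    rw [← lintegral_const_mul' _ _ enorm_ne_top]
    calc ∫⁻ x, ‖t - s‖ₑ * ‖g x‖ₑ ∂μX
        ≤ ∫⁻ x, (‖pt x‖ₑ + (‖ps x‖ₑ + ‖pt x - ps x - (t - s) * g x‖ₑ)) ∂μX := by
          refine lintegral_mono fun x => ?_
          rw [← enorm_mul]
          have : (t - s) * g x = pt x - (ps x + (pt x - ps x - (t - s) * g x)) := by ring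
          calc ‖(t - s) * g x‖ₑ = ‖pt x - (ps x + (pt x - ps x - (t - s) * g x))‖ₑ := by
                rw [← this]
            _ ≤ ‖pt x‖ₑ + ‖ps x + (pt x - ps x - (t - s) * g x)‖ₑ := enorm_sub_le
            _ ≤ _ := by gcongr; exact enorm_add_le _ _
      _ ≤ ENNReal.ofReal U + (ENNReal.ofReal U + ENNReal.ofReal (B * (t - s) ^ 2)) := by
          rw [lintegral_add_left hpt.enorm, lintegral_add_left hps.enorm]
          exact add_le_add ht (add_le_add hs h)
      _ ≤ ENNReal.ofReal (2 * U + B * D ^ 2) := by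
          rw [← ENNReal.ofReal_add hU (by positivity), ← ENNReal.ofReal_add hU (by positivity)]
          refine ENNReal.ofReal_le_ofReal ?_
          have : (t - s) ^ 2 ≤ D ^ 2 := by
            rw [← sq_abs]; exact pow_le_pow_left₀ (abs_nonneg _) hD 2
          nlinarith
  rw [ENNReal.ofReal_div_of_pos hδ, ENNReal.le_div_iff_mul_le (Or.inl (by simpa using hδ))
    (Or.inl ENNReal.ofReal_ne_top), mul_comm]
  refine le_trans (mul_le_mul_left ?_ _) h1
  rw [← ofReal_norm]
  exact ENNReal.ofReal_le_ofReal hδt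

/-- Densities as in `HasBoundedDensity` and `HasSmoothDensity` give a smooth disintegration, on an
interval `𝒮` that is bounded and has nonempty interior. -/
theorem exists_isSmoothDisintegration {X : Type*} [MeasurableSpace X] {P : Measure (X × ℝ)}
    [IsProbabilityMeasure P] {𝒮 : Set ℝ} (h𝒮 : 𝒮.OrdConnected)
    (hPS : HasBoundedDensity (P.map Prod.snd) 𝒮) (hP : HasSmoothDensity P 𝒮) :
    (∃ D : ℝ, ∀ s ∈ 𝒮, ∀ t ∈ 𝒮, |t - s| ≤ D) ∧ (∃ a b : ℝ, a < b ∧ Set.Icc a b ⊆ 𝒮) ∧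
      ∃ m L U B B₁, IsSmoothDisintegration P 𝒮 m L U B B₁ := by
  obtain ⟨q, hqm, hq, L, U, hL, hLU, hqLU⟩ := hPS
  obtain ⟨μX, p, hσ, hpm, hp0, hPp, hpd, B, hB⟩ := hP
  have hU : 0 < U := hL.trans hLU
  have hSm : MeasurableSet 𝒮 := h𝒮.measurableSet
  have hmarg : P.map Prod.snd =
      (volume.restrict 𝒮).withDensity fun s => ∫⁻ x, ENNReal.ofReal (p x s) ∂μX := by
    conv_lhs => rw [hPp]
    exact map_snd_withDensity_prod (f := fun w => ENNReal.ofReal (p w.1 w.2)) hpm.ennreal_ofReal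
  have hprob : IsProbabilityMeasure (P.map Prod.snd) :=
    Measure.isProbabilityMeasure_map measurable_snd.aemeasurable
  have hq1 : ∫⁻ s in 𝒮, ENNReal.ofReal (q s) = 1 := by
    have := hprob.measure_univ
    rw [hq, withDensity_apply _ MeasurableSet.univ, Measure.restrict_univ] at this
    exact this
  have hvol := volume_le_of_withDensity hSm hq1.le hL fun s hs => (hqLU s hs).1
  have hD0 : (0 : ℝ) ≤ 1 / L := by positivity
  have hD : ∀ s ∈ 𝒮, ∀ t ∈ 𝒮, |t - s| ≤ 1 / L := fun s hs t ht =>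
    h𝒮.abs_sub_le_of_volume_le hD0 hvol hs ht
  have hvol0 : volume 𝒮 ≠ 0 := fun h0 => by
    rw [Measure.restrict_eq_zero.2 h0] at hq1
    simp at hq1
  obtain ⟨a, b, hab, habS⟩ := h𝒮.exists_Icc_subset_interior hvol0
  refine ⟨⟨1 / L, hD⟩, ⟨a, b, hab, habS.trans interior_subset⟩, ?_⟩
  -- the two expressions for the density of the second marginal agree almost everywhere
  have hqae : ∀ᵐ s ∂(volume.restrict 𝒮),
      ENNReal.ofReal (q s) = ∫⁻ x, ENNReal.ofReal (p x s) ∂μX := by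
    refine (withDensity_eq_iff hqm.ennreal_ofReal.aemeasurable ?_ (by rw [hq1]; simp)).1
      (hq.symm.trans hmarg)
    exact (hpm.ennreal_ofReal.lintegral_prod_left').aemeasurable
  have hpsm : ∀ s, Measurable fun x => p x s := fun s => hpm.comp measurable_prodMk_right
  set Good : Set ℝ := {s | s ∈ interior 𝒮 ∧ ∫⁻ x, ‖p x s‖ₑ ∂μX = ENNReal.ofReal (q s)} with hGood
  have hgood : ∀ᵐ s ∂(volume.restrict 𝒮), s ∈ Good := by
    filter_upwards [hqae, h𝒮.ae_mem_interior] with s hs hsI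
    refine ⟨hsI, ?_⟩
    rw [hs]
    exact lintegral_congr fun x => Real.enorm_of_nonneg (hp0 x s (interior_subset hsI))
  have hGS : ∀ s ∈ Good, s ∈ 𝒮 := fun s hs => interior_subset hs.1
  have hGint : ∀ s ∈ Good, Integrable (fun x => p x s) μX := fun s hs =>
    ⟨(hpsm s).aestronglyMeasurable, by
      rw [HasFiniteIntegral, hs.2]; exact ENNReal.ofReal_lt_top⟩
  have hGone : ∀ s ∈ Good, ∫ x, p x s ∂μX = q s := fun s hs => by
    have h1 : ∫ x, p x s ∂μX = (∫⁻ x, ‖p x s‖ₑ ∂μX).toReal := by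
      rw [integral_eq_lintegral_of_nonneg_ae
        (Eventually.of_forall fun x => hp0 x s (hGS s hs)) (hpsm s).aestronglyMeasurable]
      congr 1
      exact lintegral_congr fun x => (Real.enorm_of_nonneg (hp0 x s (hGS s hs))).symm
    rw [h1, hs.2, ENNReal.toReal_ofReal (hL.trans (hqLU s (hGS s hs)).1).le]
  -- the derivatives, and the Taylor estimate on the interior
  set g₁ : X → ℝ → ℝ := fun x => derivWithin (p x) 𝒮 with hg₁
  set g₂ : X → ℝ → ℝ := fun x => derivWithin (derivWithin (p x) 𝒮) 𝒮 with hg₂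
  have hnhds : ∀ s ∈ interior 𝒮, 𝒮 ∈ 𝓝 s := fun s hs => mem_interior_iff_mem_nhds.1 hs
  have hd1 : ∀ x, ∀ s ∈ interior 𝒮, HasDerivAt (p x) (g₁ x s) s := fun x s hs =>
    (((hpd x).1 s (interior_subset hs)).hasDerivWithinAt).hasDerivAt (hnhds s hs)
  have hd2 : ∀ x, ∀ s ∈ interior 𝒮, HasDerivAt (g₁ x) (g₂ x s) s := fun x s hs =>
    (((hpd x).2.1 s (interior_subset hs)).hasDerivWithinAt).hasDerivAt (hnhds s hs)
  have hIord : (interior 𝒮).OrdConnected := h𝒮.interior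
  have htaylor : ∀ s ∈ interior 𝒮, ∀ t ∈ interior 𝒮,
      ∫⁻ x, ‖p x t - p x s - (t - s) * g₁ x s‖ₑ ∂μX ≤ ENNReal.ofReal (B * (t - s) ^ 2) :=
    fun s hs t ht => lintegral_taylor_le isOpen_interior hIord hpm hd1 hd2
      (fun x => by
        obtain ⟨Bx, hBx⟩ := (hpd x).2.2
        exact ⟨Bx, fun r hr => hBx r (interior_subset hr)⟩)
      (fun r hr => hB r (interior_subset hr)) hs ht
  have hg₁m : ∀ s ∈ interior 𝒮, Measurable fun x => g₁ x s := fun s hs => by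
    have h1 := (measurable_rightQuotientLimsup hpm).comp (measurable_prodMk_right (y := s) (α := X))
    have h2 : (fun x => g₁ x s) =
        rightQuotientLimsup (Function.uncurry p) ∘ fun x => (x, s) :=
      funext fun x => (rightQuotientLimsup_eq (hd1 x s hs)).symm
    rw [h2]; exact h1
  have hexists : ∀ c d : ℝ, c < d → Set.Icc c d ⊆ interior 𝒮 → ∃ t ∈ Good, t ∈ Set.Icc c d := by
    intro c d hcd hsub
    by_contra! hcon
    rw [ae_restrict_iff' hSm] at hgood
    have h1 : volume (Set.Icc c d) = 0 := by
      refine measure_mono_null (fun t ht => ?_) (ae_iff.1 hgood)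
      exact fun h => hcon t (h (interior_subset (hsub ht))) ht
    rw [Real.volume_Icc, ENNReal.ofReal_eq_zero] at h1
    linarith
  set δ := (b - a) / 4 with hδ
  have hδ0 : 0 < δ := by rw [hδ]; linarith
  obtain ⟨t₁, ht₁, ht₁'⟩ := hexists a (a + δ) (by linarith)
    (fun x hx => habS ⟨hx.1, by linarith [hx.2]⟩)
  obtain ⟨t₂, ht₂, ht₂'⟩ := hexists (b - δ) b (by linarith)
    (fun x hx => habS ⟨by linarith [hx.1], hx.2⟩)
  set B₁ := (2 * U + B * (1 / L) ^ 2) / δ with hB₁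
  have hB₁0 : 0 ≤ B₁ := by have := B.coe_nonneg; positivity
  have hpU : ∀ s ∈ Good, ∫⁻ x, ‖p x s‖ₑ ∂μX ≤ ENNReal.ofReal U := fun s hs => by
    rw [hs.2]; exact ENNReal.ofReal_le_ofReal (hqLU s (hGS s hs)).2.le
  have hslope : ∀ s ∈ Good, ∫⁻ x, ‖g₁ x s‖ₑ ∂μX ≤ ENNReal.ofReal B₁ := by
    intro s hs
    have key : ∀ t ∈ Good, δ ≤ |t - s| → ∫⁻ x, ‖g₁ x s‖ₑ ∂μX ≤ ENNReal.ofReal B₁ :=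
      fun t ht hst => lintegral_slope_le (hpsm s) (hpsm t) (hpU s hs) (hpU t ht) hU.le
        B.coe_nonneg hδ0 hst (hD s (hGS s hs) t (hGS t ht)) (htaylor s hs.1 t ht.1)
    -- one of the two reference points, which are `2 * δ` apart, is far from `s`
    rcases le_or_gt δ |t₁ - s| with h | h
    · exact key t₁ ht₁ h
    · refine key t₂ ht₂ ?_
      have h1 := abs_lt.1 h
      have h2 := le_abs_self (t₂ - s)
      linarith [ht₁'.2, ht₂'.1]
  have hg₁i : ∀ s ∈ Good, Integrable (fun x => g₁ x s) μX := fun s hs =>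
    ⟨(hg₁m s hs.1).aestronglyMeasurable, by
      rw [HasFiniteIntegral]; exact (hslope s hs).trans_lt ENNReal.ofReal_lt_top⟩
  have hwi : ∀ (w : X → ℝ), Measurable w → (∀ x, |w x| ≤ 1) → ∀ f : X → ℝ, Integrable f μX →
      Integrable (fun x => w x * f x) μX := fun w hw hw1 f hf =>
    hf.bdd_mul hw.aestronglyMeasurable (Eventually.of_forall hw1)
  -- weighting by `w` does not increase the `L¹` norm
  have hwle : ∀ (w : X → ℝ), (∀ x, |w x| ≤ 1) → ∀ (f : X → ℝ) (C : ℝ), 0 ≤ C →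
      ∫⁻ x, ‖f x‖ₑ ∂μX ≤ ENNReal.ofReal C → |∫ x, w x * f x ∂μX| ≤ C := by
    intro w hw1 f C hC hf
    have h1 : ‖∫ x, w x * f x ∂μX‖ₑ ≤ ENNReal.ofReal C := by
      refine (enorm_integral_le_lintegral_enorm _).trans (le_trans (lintegral_mono fun x => ?_) hf)
      rw [enorm_mul]
      have h2 : ‖w x‖ₑ ≤ 1 := by
        rw [← ofReal_norm, ← ENNReal.ofReal_one]
        exact ENNReal.ofReal_le_ofReal (hw1 x)
      calc ‖w x‖ₑ * ‖f x‖ₑ ≤ 1 * ‖f x‖ₑ := mul_le_mul_left h2 _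
        _ = ‖f x‖ₑ := one_mul _
    rw [← ofReal_norm] at h1
    exact (ENNReal.ofReal_le_ofReal_iff hC).1 h1
  refine ⟨fun w s => ∫ x, w x * p x s ∂μX, L, U, B, B₁, hL, hU, B.coe_nonneg, hB₁0, ?_, ?_, ?_, ?_,
    ?_⟩
  · intro w hw
    exact ((hw.comp measurable_fst).mul hpm).stronglyMeasurable.integral_prod_left'.measurable
  · intro w hw hw1 φ hφ hφC
    obtain ⟨C, hC⟩ := hφC
    have hFm : Measurable fun z : X × ℝ => φ z.2 * w z.1 :=
      (hφ.comp measurable_snd).mul (hw.comp measurable_fst)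
    have hFi : Integrable (fun z : X × ℝ => φ z.2 * w z.1) P :=
      Integrable.of_bound hFm.aestronglyMeasurable (C * 1) (Eventually.of_forall fun z => by
        rw [Real.norm_eq_abs, abs_mul]
        exact mul_le_mul (hC _) (hw1 _) (abs_nonneg _) ((abs_nonneg _).trans (hC z.2)))
    have hpo : Measurable fun z : X × ℝ => ENNReal.ofReal (p z.1 z.2) := hpm.ennreal_ofReal
    rw [hPp] at hFi ⊢
    rw [integral_withDensity_eq_integral_toReal_smul hpo
      (Eventually.of_forall fun z => ENNReal.ofReal_lt_top)]
    rw [integrable_withDensity_iff_integrable_smul' hpo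
      (Eventually.of_forall fun z => ENNReal.ofReal_lt_top)] at hFi
    rw [integral_prod_symm _ hFi]
    refine setIntegral_congr_fun hSm fun s hs => ?_
    simp only [smul_eq_mul]
    rw [← integral_const_mul]
    refine integral_congr_ae (Eventually.of_forall fun x => ?_)
    simp only [ENNReal.toReal_ofReal (hp0 x s hs)]; ring
  · filter_upwards [hgood] with s hs
    simp only [one_mul, hGone s hs]
    exact ⟨(hqLU s (hGS s hs)).1.le, (hqLU s (hGS s hs)).2.le⟩
  · intro w hw hw1
    filter_upwards [hgood] with s hs
    simp only [one_mul, hGone s hs]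
    exact hwle w hw1 _ _ (hL.trans (hqLU s (hGS s hs)).1).le hs.2.le
  · intro w hw hw1
    filter_upwards [hgood] with s hs
    refine ⟨∫ x, w x * g₁ x s ∂μX, hwle w hw1 _ _ hB₁0 (hslope s hs), ?_⟩
    filter_upwards [hgood] with t ht
    have h1 : ∫ x, w x * p x t ∂μX - ∫ x, w x * p x s ∂μX - (t - s) * ∫ x, w x * g₁ x s ∂μX =
        ∫ x, w x * (p x t - p x s - (t - s) * g₁ x s) ∂μX := by
      have h2 : Integrable (fun x => w x * p x t - w x * p x s) μX :=
        (hwi w hw hw1 _ (hGint t ht)).sub (hwi w hw hw1 _ (hGint s hs))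
      rw [← integral_const_mul, ← integral_sub (hwi w hw hw1 _ (hGint t ht))
        (hwi w hw hw1 _ (hGint s hs)),
        ← integral_sub h2 ((hwi w hw hw1 _ (hg₁i s hs)).const_mul _)]
      exact integral_congr_ae (Eventually.of_forall fun x => by ring)
    rw [h1]
    exact hwle w hw1 _ _ (by have := B.coe_nonneg; positivity) (htaylor s hs.1 t ht.1)

/-! ### Moments, mass and bias of the smoothing kernel on an interval -/

theorem integrable_comp_sub_div {F : ℝ → ℝ} (hF : Integrable F) {γ : ℝ} (hγ : 0 < γ) (s : ℝ) :
    Integrable fun t => F ((t - s) / γ) :=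
  (hF.comp_div hγ.ne').comp_sub_right s

theorem integral_comp_sub_div_eq (F : ℝ → ℝ) {γ : ℝ} (hγ : 0 < γ) (s : ℝ) :
    ∫ t, F ((t - s) / γ) = γ * ∫ u, F u := by
  rw [integral_sub_right_eq_self (fun t => F (t / γ)) s, Measure.integral_comp_div,
    abs_of_pos hγ, smul_eq_mul]

theorem IsKernelProfile.integrable {k : ℝ → ℝ} (hk : IsKernelProfile k) : Integrable k := by
  by_contra h
  have := hk.integral_eq_one
  rw [integral_undef h] at this
  exact zero_ne_one this

theorem IsKernelProfile.integrable_mul_abs {k : ℝ → ℝ} (hk : IsKernelProfile k) :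
    Integrable fun u => k u * |u| := by
  refine Integrable.mono' (hk.integrable.add hk.second_moment)
    (hk.measurable.mul measurable_abs).aestronglyMeasurable (Eventually.of_forall fun u => ?_)
  have h0 := hk.nonneg u
  rw [Real.norm_eq_abs, abs_mul, abs_abs, abs_of_nonneg h0, Pi.add_apply]
  nlinarith [sq_nonneg (|u| - 1), sq_abs u, abs_nonneg u]

theorem IsKernelProfile.integrable_mul {k : ℝ → ℝ} (hk : IsKernelProfile k) :
    Integrable fun u => k u * u := by
  refine Integrable.mono' hk.integrable_mul_abs
    (hk.measurable.mul measurable_id).aestronglyMeasurable (Eventually.of_forall fun u => ?_)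
  rw [Real.norm_eq_abs, abs_mul, abs_of_nonneg (hk.nonneg u)]

theorem IsKernelProfile.integrable_scaled_mul_abs {k : ℝ → ℝ} (hk : IsKernelProfile k) {γ : ℝ}
    (hγ : 0 < γ) (s : ℝ) : Integrable fun t => k ((t - s) / γ) * |t - s| := by
  have h := (integrable_comp_sub_div hk.integrable_mul_abs hγ s).const_mul γ
  refine h.congr (Eventually.of_forall fun t => ?_)
  simp only [abs_div, abs_of_pos hγ]; field_simp

theorem IsKernelProfile.integrable_scaled_mul {k : ℝ → ℝ} (hk : IsKernelProfile k) {γ : ℝ}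
    (hγ : 0 < γ) (s : ℝ) : Integrable fun t => k ((t - s) / γ) * (t - s) := by
  have h := (integrable_comp_sub_div hk.integrable_mul hγ s).const_mul γ
  refine h.congr (Eventually.of_forall fun t => ?_)
  field_simp

theorem IsKernelProfile.integrable_scaled_mul_sq {k : ℝ → ℝ} (hk : IsKernelProfile k) {γ : ℝ}
    (hγ : 0 < γ) (s : ℝ) : Integrable fun t => k ((t - s) / γ) * (t - s) ^ 2 := by
  have h := (integrable_comp_sub_div hk.second_moment hγ s).const_mul (γ ^ 2)
  refine h.congr (Eventually.of_forall fun t => ?_)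
  field_simp

theorem integral_scaled_kernel_mul_sq {k : ℝ → ℝ} {γ : ℝ}
    (hγ : 0 < γ) (s : ℝ) :
    ∫ t, k ((t - s) / γ) * (t - s) ^ 2 = γ ^ 3 * ∫ u, u ^ 2 * k u := by
  have h := integral_comp_sub_div_eq (fun u => u ^ 2 * k u) hγ s
  have h2 : ∀ t, k ((t - s) / γ) * (t - s) ^ 2 =
      γ ^ 2 * (((t - s) / γ) ^ 2 * k ((t - s) / γ)) := fun t => by field_simp
  simp_rw [h2]
  rw [integral_const_mul, h]; ring

theorem integral_scaled_kernel_mul_abs {k : ℝ → ℝ} {γ : ℝ}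
    (hγ : 0 < γ) (s : ℝ) :
    ∫ t, k ((t - s) / γ) * |t - s| = γ ^ 2 * ∫ u, k u * |u| := by
  have h := integral_comp_sub_div_eq (fun u => k u * |u|) hγ s
  have h2 : ∀ t, k ((t - s) / γ) * |t - s| =
      γ * (k ((t - s) / γ) * |(t - s) / γ|) := fun t => by
    rw [abs_div, abs_of_pos hγ]; field_simp
  simp_rw [h2]
  rw [integral_const_mul, h]; ring

theorem IsKernelProfile.integral_scaled_mul {k : ℝ → ℝ} (hk : IsKernelProfile k) {γ : ℝ}
    (hγ : 0 < γ) (s : ℝ) : ∫ t, k ((t - s) / γ) * (t - s) = 0 := by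
  have h := integral_comp_sub_div_eq (fun u => k u * u) hγ s
  have h0 : ∫ u, k u * u = 0 := by
    have h1 := integral_neg_eq_self (fun u => k u * u) (volume : Measure ℝ)
    simp only [← hk.symm, mul_neg, integral_neg] at h1
    linarith
  have h2 : ∀ t, k ((t - s) / γ) * (t - s) = γ * (k ((t - s) / γ) * ((t - s) / γ)) := fun t => by
    field_simp
  simp_rw [h2]
  rw [integral_const_mul, h, h0]; ring

/-- The first absolute moment, at bandwidth `γ`, of the part of the kernel centred at `s` that falls
outside `𝒮`. It controls the first-order bias caused by the boundary of `𝒮`. -/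
noncomputable def boundaryMoment (k : ℝ → ℝ) (γ : ℝ) (𝒮 : Set ℝ) (s : ℝ) : ℝ :=
  ∫ t in 𝒮ᶜ, k ((t - s) / γ) * |t - s|

section Boundary

variable {k : ℝ → ℝ} {γ : ℝ} {𝒮 : Set ℝ}

theorem boundaryMoment_nonneg (hk : IsKernelProfile k) (s : ℝ) : 0 ≤ boundaryMoment k γ 𝒮 s :=
  integral_nonneg fun _ => mul_nonneg (hk.nonneg _) (abs_nonneg _)

theorem boundaryMoment_le (hk : IsKernelProfile k) (hγ : 0 < γ) (s : ℝ) :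
    boundaryMoment k γ 𝒮 s ≤ γ ^ 2 * ∫ u, k u * |u| := by
  rw [← integral_scaled_kernel_mul_abs hγ s]
  exact setIntegral_le_integral (hk.integrable_scaled_mul_abs hγ s)
    (Eventually.of_forall fun _ => mul_nonneg (hk.nonneg _) (abs_nonneg _))

theorem measurable_kernel_prod (hk : Measurable k) :
    Measurable fun z : ℝ × ℝ => k ((z.2 - z.1) / γ) :=
  hk.comp ((measurable_snd.sub measurable_fst).div_const γ)

theorem measurable_boundaryMoment (hk : IsKernelProfile k) :
    Measurable (boundaryMoment k γ 𝒮) := by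
  have h : Measurable fun z : ℝ × ℝ => k ((z.2 - z.1) / γ) * |z.2 - z.1| :=
    (measurable_kernel_prod hk.measurable).mul (measurable_snd.sub measurable_fst).abs
  exact (h.stronglyMeasurable.integral_prod_right (ν := volume.restrict 𝒮ᶜ)).measurable

/-- By the symmetry of the kernel the first moment over `𝒮` is minus that over the complement. -/
theorem abs_setIntegral_kernel_mul_le (hk : IsKernelProfile k) (hγ : 0 < γ)
    (h𝒮 : MeasurableSet 𝒮) (s : ℝ) :
    |∫ t in 𝒮, k ((t - s) / γ) * (t - s)| ≤ boundaryMoment k γ 𝒮 s := by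
  have h := integral_add_compl h𝒮 (hk.integrable_scaled_mul hγ s)
  rw [hk.integral_scaled_mul hγ s] at h
  rw [eq_neg_of_add_eq_zero_left h, abs_neg]
  refine abs_integral_le_integral_abs.trans (le_of_eq ?_)
  refine integral_congr_ae (Eventually.of_forall fun t => ?_)
  simp only [abs_mul, abs_of_nonneg (hk.nonneg _)]

/-- The points that a translation by `u` moves out of an interval have measure at most `|u|`. -/
theorem Set.OrdConnected.volume_shift_out_le (h𝒮 : 𝒮.OrdConnected) {D : ℝ}
    (hD : ∀ s ∈ 𝒮, ∀ t ∈ 𝒮, |t - s| ≤ D) (u : ℝ) :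
    volume {s | s ∈ 𝒮 ∧ s + u ∉ 𝒮} ≤ ENNReal.ofReal |u| := by
  rcases 𝒮.eq_empty_or_nonempty with rfl | ⟨c, hc⟩
  · simp
  have hbddA : BddAbove 𝒮 := ⟨c + D, fun t ht => by
    have := (abs_le.1 (hD c hc t ht)).2; linarith⟩
  have hbddB : BddBelow 𝒮 := ⟨c - D, fun t ht => by
    have := (abs_le.1 (hD c hc t ht)).1; linarith⟩
  rcases le_total 0 u with hu | hu
  · have hsub : {s | s ∈ 𝒮 ∧ s + u ∉ 𝒮} ⊆ Set.Icc (sSup 𝒮 - u) (sSup 𝒮) := by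
      rintro s ⟨hs, hsu⟩
      refine ⟨?_, le_csSup hbddA hs⟩
      by_contra! hlt
      obtain ⟨y, hy, hlt'⟩ := exists_lt_of_lt_csSup ⟨c, hc⟩ (show s + u < sSup 𝒮 by linarith)
      exact hsu (h𝒮.out hs hy ⟨by linarith, hlt'.le⟩)
    refine (measure_mono hsub).trans (le_of_eq ?_)
    rw [Real.volume_Icc, abs_of_nonneg hu]; congr 1; ring
  · have hsub : {s | s ∈ 𝒮 ∧ s + u ∉ 𝒮} ⊆ Set.Icc (sInf 𝒮) (sInf 𝒮 - u) := by
      rintro s ⟨hs, hsu⟩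
      refine ⟨csInf_le hbddB hs, ?_⟩
      by_contra! hlt
      obtain ⟨y, hy, hlt'⟩ := exists_lt_of_csInf_lt ⟨c, hc⟩ (show sInf 𝒮 < s + u by linarith)
      exact hsu (h𝒮.out hy hs ⟨hlt'.le, by linarith⟩)
    refine (measure_mono hsub).trans (le_of_eq ?_)
    rw [Real.volume_Icc, abs_of_nonpos hu]; congr 1; ring

/-- The boundary moment is of order `γ ^ 2` near the boundary, but of order `γ ^ 3` in the mean over
`𝒮`: after exchanging the integrals, the shift `u` meets a set of starting points of measure at most
`|u|`, which turns the first moment of the kernel into the second. -/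
theorem setIntegral_boundaryMoment_le (hk : IsKernelProfile k) (hγ : 0 < γ)
    (h𝒮 : 𝒮.OrdConnected) {D : ℝ} (hD : ∀ s ∈ 𝒮, ∀ t ∈ 𝒮, |t - s| ≤ D) :
    ∫ s in 𝒮, boundaryMoment k γ 𝒮 s ≤ γ ^ 3 * ∫ u, u ^ 2 * k u := by
  have hSm := h𝒮.measurableSet
  have hκ : 0 ≤ ∫ u, u ^ 2 * k u :=
    integral_nonneg fun u => mul_nonneg (sq_nonneg u) (hk.nonneg u)
  have hkm : Measurable fun u : ℝ => ENNReal.ofReal (k (u / γ) * |u|) :=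
    ((hk.measurable.comp (measurable_id.div_const γ)).mul measurable_abs).ennreal_ofReal
  have hpt : ∀ s, ENNReal.ofReal (boundaryMoment k γ 𝒮 s) =
      ∫⁻ u, {u | s + u ∉ 𝒮}.indicator (fun u => ENNReal.ofReal (k (u / γ) * |u|)) u := by
    intro s
    rw [boundaryMoment, ofReal_integral_eq_lintegral_ofReal
      (hk.integrable_scaled_mul_abs hγ s).integrableOn
      (Eventually.of_forall fun _ => mul_nonneg (hk.nonneg _) (abs_nonneg _)),
      ← lintegral_indicator hSm.compl,
      ← lintegral_add_left_eq_self _ s]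
    refine lintegral_congr fun u => ?_
    by_cases hu : s + u ∈ 𝒮
    · simp [hu]
    · simp [hu]
  have hjoint : Measurable fun z : ℝ × ℝ => {u | z.1 + u ∉ 𝒮}.indicator
      (fun u => ENNReal.ofReal (k (u / γ) * |u|)) z.2 := by
    have hA : MeasurableSet {z : ℝ × ℝ | z.1 + z.2 ∉ 𝒮} :=
      (hSm.preimage (measurable_fst.add measurable_snd)).compl
    have h := (hkm.comp (measurable_snd (α := ℝ))).indicator hA
    exact h
  have key : ENNReal.ofReal (∫ s in 𝒮, boundaryMoment k γ 𝒮 s) ≤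
      ENNReal.ofReal (γ ^ 3 * ∫ u, u ^ 2 * k u) := by
    rw [ofReal_integral_eq_lintegral_ofReal]
    · simp_rw [hpt]
      rw [lintegral_lintegral_swap hjoint.aemeasurable]
      calc _ ≤ ∫⁻ u, ENNReal.ofReal (k ((u - 0) / γ) * (u - 0) ^ 2) := by
            refine lintegral_mono fun u => ?_
            have hA : MeasurableSet {s : ℝ | s + u ∉ 𝒮} :=
              (hSm.preimage (measurable_id.add_const u)).compl
            calc ∫⁻ s in 𝒮, {u | s + u ∉ 𝒮}.indicator (fun u => ENNReal.ofReal (k (u / γ) * |u|)) u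
                = ∫⁻ s in 𝒮, {s | s + u ∉ 𝒮}.indicator
                    (fun _ => ENNReal.ofReal (k (u / γ) * |u|)) s := rfl
              _ = ENNReal.ofReal (k (u / γ) * |u|) * volume {s | s ∈ 𝒮 ∧ s + u ∉ 𝒮} := by
                  rw [lintegral_indicator_const hA, Measure.restrict_apply hA, Set.inter_comm]
                  rfl
              _ ≤ ENNReal.ofReal (k (u / γ) * |u|) * ENNReal.ofReal |u| :=
                  mul_le_mul_right (h𝒮.volume_shift_out_le hD u) _
              _ = ENNReal.ofReal (k ((u - 0) / γ) * (u - 0) ^ 2) := by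
                  rw [← ENNReal.ofReal_mul (mul_nonneg (hk.nonneg _) (abs_nonneg _)), sub_zero,
                    mul_assoc, abs_mul_abs_self, sq]
        _ = _ := by
            rw [← ofReal_integral_eq_lintegral_ofReal (hk.integrable_scaled_mul_sq hγ 0)
              (Eventually.of_forall fun _ => mul_nonneg (hk.nonneg _) (sq_nonneg _)),
              integral_scaled_kernel_mul_sq hγ 0]
    · have hfin : volume 𝒮 ≠ ⊤ := by
        refine (Bornology.IsBounded.measure_lt_top (Metric.isBounded_iff.2 ⟨D, ?_⟩)).ne
        exact fun s hs t ht => by rw [dist_comm, Real.dist_eq]; exact hD s hs t ht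
      refine Measure.integrableOn_of_bounded (M := γ ^ 2 * ∫ u, k u * |u|) hfin
        (measurable_boundaryMoment hk).aestronglyMeasurable (Eventually.of_forall fun s => ?_)
      rw [Real.norm_eq_abs, abs_of_nonneg (boundaryMoment_nonneg hk s)]
      exact boundaryMoment_le hk hγ s
    · exact Eventually.of_forall fun s => boundaryMoment_nonneg hk s
  exact (ENNReal.ofReal_le_ofReal_iff (by positivity)).1 key

end Boundary

/-- For small bandwidths a quarter of the mass of the kernel centred at a point of an interval falls
into the interval: the interval extends to a fixed distance on one side of the point, and each side
carries half of the mass. -/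
theorem exists_forall_kernel_mass_ge {k : ℝ → ℝ} (hk : IsKernelProfile k) {𝒮 : Set ℝ}
    (h𝒮 : 𝒮.OrdConnected) {a b : ℝ} (hab : a < b) (hsub : Set.Icc a b ⊆ 𝒮) :
    ∃ γ₀ > 0, ∀ γ, 0 < γ → γ ≤ γ₀ → ∀ s ∈ 𝒮, γ / 4 ≤ ∫ t in 𝒮, k ((t - s) / γ) := by
  have hhalf : ∫ u in Set.Ioi (0 : ℝ), k u = 1 / 2 := by
    have h1 : ∫ u in Set.Iic (0 : ℝ), k u = ∫ u in Set.Ioi (0 : ℝ), k u := by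
      have := integral_comp_neg_Iic (0 : ℝ) k
      simp only [← hk.symm, neg_zero] at this
      exact this
    have h2 := intervalIntegral.integral_Iic_add_Ioi (b := (0 : ℝ)) (f := k) (μ := volume)
      hk.integrable.integrableOn hk.integrable.integrableOn
    rw [hk.integral_eq_one, h1] at h2
    linarith
  have hlim := intervalIntegral_tendsto_integral_Ioi (0 : ℝ)
    (hk.integrable.integrableOn (s := Set.Ioi 0)) tendsto_id
  rw [hhalf] at hlim
  obtain ⟨R, hR⟩ := eventually_atTop.1
    (hlim.eventually (lt_mem_nhds (show (1 / 4 : ℝ) < 1 / 2 by norm_num)))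
  set d := (b - a) / 2 with hd
  have hd0 : 0 < d := by rw [hd]; linarith
  refine ⟨d / max R 1, by positivity, fun γ hγ hγd s hs => ?_⟩
  have hRγ : R ≤ d / γ := by
    rw [le_div_iff₀ hγ]
    rw [le_div_iff₀ (by positivity)] at hγd
    have := mul_le_mul_of_nonneg_left (le_max_left R 1) hγ.le
    linarith
  have hmass := hR (d / γ) hRγ
  simp only [id] at hmass
  have hmono : ∀ c e : ℝ, c ≤ e → Set.Icc c e ⊆ 𝒮 →
      ∫ t in c..e, k ((t - s) / γ) ≤ ∫ t in 𝒮, k ((t - s) / γ) := fun c e hce hce𝒮 => by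
    rw [intervalIntegral.integral_of_le hce]
    exact setIntegral_mono_set (integrable_comp_sub_div hk.integrable hγ s).integrableOn
      (Eventually.of_forall fun t => hk.nonneg _)
      ((Set.Ioc_subset_Icc_self.trans hce𝒮).eventuallyLE)
  have hval : ∀ c e : ℝ, ∫ t in c..e, k ((t - s) / γ) =
      γ * ∫ u in (c - s) / γ..(e - s) / γ, k u := fun c e => by
    rw [intervalIntegral.integral_comp_sub_right (fun t => k (t / γ)) s,
      intervalIntegral.integral_comp_div _ hγ.ne', smul_eq_mul]
  rcases le_total s ((a + b) / 2) with h | h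
  · have h1 := hmono s (s + d) (by linarith) fun t ht => by
      rcases le_total t b with htb | htb
      · rcases le_total a t with hta | hta
        · exact hsub ⟨hta, htb⟩
        · exact h𝒮.out hs (hsub ⟨le_rfl, hab.le⟩) ⟨ht.1, hta⟩
      · exact hsub ⟨by linarith, by linarith [ht.2]⟩
    rw [hval, sub_self, zero_div, add_sub_cancel_left] at h1
    nlinarith
  · have h1 := hmono (s - d) s (by linarith) fun t ht => by
      rcases le_total a t with hta | hta
      · rcases le_total t b with htb | htb
        · exact hsub ⟨hta, htb⟩
        · exact h𝒮.out (hsub ⟨hab.le, le_rfl⟩) hs ⟨htb, ht.2⟩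
      · exact hsub ⟨by linarith [ht.1], by linarith⟩
    rw [hval, sub_self, zero_div] at h1
    have h2 : ∫ u in (s - d - s) / γ..0, k u = ∫ u in (0 : ℝ)..d / γ, k u := by
      have h3 := intervalIntegral.integral_comp_neg (a := 0) (b := d / γ) k
      simp only [← hk.symm, neg_zero] at h3
      rw [h3]; congr 1; ring
    rw [h2] at h1
    nlinarith

section Bias

variable {X : Type*} [MeasurableSpace X] {P : Measure (X × ℝ)} {𝒮 : Set ℝ}
  {m : (X → ℝ) → ℝ → ℝ} {L U B B₁ : ℝ} {k : ℝ → ℝ} {γ : ℝ}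

theorem IsSmoothDisintegration.integrableOn_kernel_mul (hm : IsSmoothDisintegration P 𝒮 m L U B B₁)
    {F : ℝ → ℝ} (hF : Integrable F) {w : X → ℝ} (hw : Measurable w) (hw1 : ∀ x, |w x| ≤ 1) :
    IntegrableOn (fun t => F t * m w t) 𝒮 := by
  refine Integrable.mul_bdd (c := U) hF.integrableOn (hm.measurable w hw).aestronglyMeasurable ?_
  filter_upwards [hm.abs_le w hw hw1, hm.one_mem] with t h1 h2
  exact h1.trans h2.2

/-- The kernel average of `m w` around `s` differs from the kernel average of `m 1`, rescaled by the
conditional mean `m w s / m 1 s`, by a quadratic term and a boundary term. -/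
theorem IsSmoothDisintegration.abs_kernel_bias_le [IsProbabilityMeasure P]
    (hm : IsSmoothDisintegration P 𝒮 m L U B B₁)
    (h𝒮 : MeasurableSet 𝒮) (hk : IsKernelProfile k) (hγ : 0 < γ) {w : X → ℝ} (hw : Measurable w)
    (hw1 : ∀ x, |w x| ≤ 1) :
    ∀ᵐ s ∂(volume.restrict 𝒮),
      |(∫ t in 𝒮, k ((t - s) / γ) * m w t) -
          m w s / m (fun _ => 1) s * ∫ t in 𝒮, k ((t - s) / γ) * m (fun _ => 1) t| ≤
        2 * B * (γ ^ 3 * ∫ u, u ^ 2 * k u) + 2 * B₁ * boundaryMoment k γ 𝒮 s := by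
  have h1m : Measurable fun _ : X => (1 : ℝ) := measurable_const
  have h11 : ∀ x : X, |(fun _ : X => (1 : ℝ)) x| ≤ 1 := fun x => by simp
  filter_upwards [hm.taylor w hw hw1, hm.taylor _ h1m h11, hm.one_mem, hm.abs_le w hw hw1] with
    s ⟨D, hD, hDt⟩ ⟨D', hD', hDt'⟩ hs1 hsw
  set T := m w s / m (fun _ => 1) s with hT
  have hpos : 0 < m (fun _ => 1) s := hm.L_pos.trans_le hs1.1
  have hT1 : |T| ≤ 1 := by
    rw [hT, abs_div, abs_of_pos hpos]; exact (div_le_one hpos).2 hsw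
  have hTs : m w s - T * m (fun _ => 1) s = 0 := by rw [hT, div_mul_cancel₀ _ hpos.ne', sub_self]
  have hki := integrable_comp_sub_div hk.integrable hγ s
  have hi1 := hm.integrableOn_kernel_mul hki hw hw1
  have hi2 := hm.integrableOn_kernel_mul hki h1m h11
  have hi3 : IntegrableOn (fun t => k ((t - s) / γ) * (t - s)) 𝒮 :=
    (hk.integrable_scaled_mul hγ s).integrableOn
  set R : ℝ → ℝ := fun t => k ((t - s) / γ) * m w t - T * (k ((t - s) / γ) * m (fun _ => 1) t) -
    (D - T * D') * (k ((t - s) / γ) * (t - s)) with hR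
  have hsplit : (∫ t in 𝒮, k ((t - s) / γ) * m w t) -
      T * ∫ t in 𝒮, k ((t - s) / γ) * m (fun _ => 1) t =
      (∫ t in 𝒮, R t) + (D - T * D') * ∫ t in 𝒮, k ((t - s) / γ) * (t - s) := by
    have hi12 : IntegrableOn (fun t => k ((t - s) / γ) * m w t -
        T * (k ((t - s) / γ) * m (fun _ => 1) t)) 𝒮 := hi1.sub (hi2.const_mul T)
    rw [hR, integral_sub hi12 (hi3.const_mul _), integral_sub hi1 (hi2.const_mul T),
      integral_const_mul, integral_const_mul]
    ring
  have hRle : |∫ t in 𝒮, R t| ≤ 2 * B * (γ ^ 3 * ∫ u, u ^ 2 * k u) := by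
    have hi4 := hk.integrable_scaled_mul_sq hγ s
    calc |∫ t in 𝒮, R t| ≤ ∫ t in 𝒮, 2 * B * (k ((t - s) / γ) * (t - s) ^ 2) := by
          refine norm_integral_le_of_norm_le (f := R) (hi4.integrableOn.const_mul _) ?_
          filter_upwards [hDt, hDt'] with t ht ht'
          have hk0 := hk.nonneg ((t - s) / γ)
          have e1 : R t = k ((t - s) / γ) * ((m w t - m w s - (t - s) * D) -
              T * (m (fun _ => 1) t - m (fun _ => 1) s - (t - s) * D')) := by
            simp only [hR]; linear_combination k ((t - s) / γ) * hTs
          have e2 : |T * (m (fun _ => 1) t - m (fun _ => 1) s - (t - s) * D')| ≤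
              B * (t - s) ^ 2 := by
            rw [abs_mul]
            calc _ ≤ 1 * (B * (t - s) ^ 2) := mul_le_mul hT1 ht' (abs_nonneg _) zero_le_one
              _ = _ := one_mul _
          rw [e1, Real.norm_eq_abs, abs_mul, abs_of_nonneg hk0]
          have e3 := abs_sub (m w t - m w s - (t - s) * D)
            (T * (m (fun _ => 1) t - m (fun _ => 1) s - (t - s) * D'))
          calc _ ≤ k ((t - s) / γ) * (2 * B * (t - s) ^ 2) :=
                mul_le_mul_of_nonneg_left (by linarith) hk0
            _ = _ := by ring
      _ = 2 * B * ∫ t in 𝒮, k ((t - s) / γ) * (t - s) ^ 2 := integral_const_mul _ _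
      _ ≤ 2 * B * ∫ t, k ((t - s) / γ) * (t - s) ^ 2 := by
          refine mul_le_mul_of_nonneg_left ?_ (by linarith [hm.B_nonneg])
          exact setIntegral_le_integral hi4
            (Eventually.of_forall fun _ => mul_nonneg (hk.nonneg _) (sq_nonneg _))
      _ = _ := by rw [integral_scaled_kernel_mul_sq hγ s]
  have hDD : |D - T * D'| ≤ 2 * B₁ := by
    have e1 : |T * D'| ≤ B₁ := by
      rw [abs_mul]
      calc _ ≤ 1 * B₁ := mul_le_mul hT1 hD' (abs_nonneg _) zero_le_one
        _ = _ := one_mul _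
    have := abs_sub D (T * D')
    linarith
  rw [hsplit]
  refine (abs_add_le _ _).trans (add_le_add hRle ?_)
  rw [abs_mul]
  exact mul_le_mul hDD (abs_setIntegral_kernel_mul_le hk hγ h𝒮 s) (abs_nonneg _)
    (by linarith [hm.B₁_nonneg])

theorem IsSmoothDisintegration.kernel_mass_ge (hm : IsSmoothDisintegration P 𝒮 m L U B B₁)
    (hk : IsKernelProfile k) (hγ : 0 < γ) {s : ℝ} (hs : γ / 4 ≤ ∫ t in 𝒮, k ((t - s) / γ)) :
    L / 4 * γ ≤ ∫ t in 𝒮, k ((t - s) / γ) * m (fun _ => 1) t := by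
  have hki := integrable_comp_sub_div hk.integrable hγ s
  have h1m : Measurable fun _ : X => (1 : ℝ) := measurable_const
  calc L / 4 * γ = L * (γ / 4) := by ring
    _ ≤ L * ∫ t in 𝒮, k ((t - s) / γ) := mul_le_mul_of_nonneg_left hs hm.L_pos.le
    _ = ∫ t in 𝒮, k ((t - s) / γ) * L := by rw [integral_mul_const, mul_comm]
    _ ≤ _ := by
        refine integral_mono_ae (hki.integrableOn.mul_const L)
          (hm.integrableOn_kernel_mul hki h1m fun x => by simp) ?_
        filter_upwards [hm.one_mem] with t ht
        exact mul_le_mul_of_nonneg_left ht.1 (hk.nonneg _)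

theorem IsSmoothDisintegration.integral_snd_le (hm : IsSmoothDisintegration P 𝒮 m L U B B₁)
    {φ : ℝ → ℝ} (hφ : Measurable φ) (hφ0 : ∀ s, 0 ≤ φ s) (hφC : ∃ C, ∀ s, |φ s| ≤ C)
    (hφi : IntegrableOn φ 𝒮) : ∫ z, φ z.2 ∂P ≤ U * ∫ s in 𝒮, φ s := by
  have h1m : Measurable fun _ : X => (1 : ℝ) := measurable_const
  have h := hm.integral_eq (fun _ => 1) h1m (fun x => by simp) φ hφ hφC
  simp only [mul_one] at h
  rw [h, mul_comm U, ← integral_mul_const]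
  have hi : IntegrableOn (fun s => φ s * m (fun _ => 1) s) 𝒮 := by
    refine Integrable.mul_bdd (c := U) hφi (hm.measurable _ h1m).aestronglyMeasurable ?_
    filter_upwards [hm.abs_le _ h1m (fun x => by simp), hm.one_mem] with t h1 h2
    exact h1.trans h2.2
  refine integral_mono_ae hi (hφi.mul_const U) ?_
  filter_upwards [hm.one_mem] with t ht
  exact mul_le_mul_of_nonneg_left ht.2 (hφ0 t)

theorem IsSmoothDisintegration.integral_sq_kernel_le [IsProbabilityMeasure P]
    (hm : IsSmoothDisintegration P 𝒮 m L U B B₁)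
    (hk : IsKernelProfile k) {M : ℝ} (hM : ∀ t, k t ≤ M) (hγ : 0 < γ) (s : ℝ)
    {w : X → ℝ} (hw1 : ∀ x, |w x| ≤ 1) :
    ∫ z, (k ((z.2 - s) / γ) * w z.1) ^ 2 ∂P ≤ M * U * γ := by
  have hM0 : 0 ≤ M := (hk.nonneg 0).trans (hM 0)
  have hkm : Measurable fun t : ℝ => k ((t - s) / γ) :=
    hk.measurable.comp ((measurable_id.sub_const s).div_const γ)
  have hki := integrable_comp_sub_div hk.integrable hγ s
  have hsq : ∀ t, k t ^ 2 ≤ M * k t := fun t => by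
    rw [sq]; exact mul_le_mul_of_nonneg_right (hM t) (hk.nonneg t)
  have hbd : ∀ t, |k t| ≤ M := fun t => by rw [abs_of_nonneg (hk.nonneg t)]; exact hM t
  have hmain := hm.integral_snd_le (φ := fun t => M * k ((t - s) / γ)) (hkm.const_mul M)
    (fun t => mul_nonneg hM0 (hk.nonneg _))
    ⟨M * M, fun t => by
      rw [abs_mul, abs_of_nonneg hM0]; exact mul_le_mul_of_nonneg_left (hbd _) hM0⟩
    (hki.integrableOn.const_mul M)
  have hpt : ∀ z : X × ℝ, (k ((z.2 - s) / γ) * w z.1) ^ 2 ≤ M * k ((z.2 - s) / γ) := fun z => by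
    rw [mul_pow]
    have h1 : w z.1 ^ 2 ≤ 1 := by rw [sq_le_one_iff_abs_le_one]; exact hw1 z.1
    calc _ ≤ k ((z.2 - s) / γ) ^ 2 * 1 := mul_le_mul_of_nonneg_left h1 (sq_nonneg _)
      _ ≤ _ := by rw [mul_one]; exact hsq _
  have hgm : Measurable fun z : X × ℝ => k ((z.2 - s) / γ) := hkm.comp measurable_snd
  have hgi : Integrable (fun z : X × ℝ => M * k ((z.2 - s) / γ)) P :=
    (Integrable.of_bound hgm.aestronglyMeasurable M
      (Eventually.of_forall fun z => hbd _)).const_mul M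
  calc _ ≤ ∫ z, M * k ((z.2 - s) / γ) ∂P :=
        integral_mono_of_nonneg (Eventually.of_forall fun _ => sq_nonneg _) hgi
          (Eventually.of_forall hpt)
    _ ≤ U * ∫ t in 𝒮, M * k ((t - s) / γ) := hmain
    _ ≤ U * ∫ t, M * k ((t - s) / γ) := by
        refine mul_le_mul_of_nonneg_left ?_ hm.U_pos.le
        exact setIntegral_le_integral (hki.const_mul M)
          (Eventually.of_forall fun _ => mul_nonneg hM0 (hk.nonneg _))
    _ = M * U * γ := by
        rw [integral_const_mul, integral_comp_sub_div_eq k hγ s, hk.integral_eq_one]; ring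

/-- The means of the kernel-weighted sums over the sample. -/
theorem IsSmoothDisintegration.integral_kernel_mul_eq (hm : IsSmoothDisintegration P 𝒮 m L U B B₁)
    {k : ℝ → ℝ} (hk : IsKernelProfile k) (γ s : ℝ) {w : X → ℝ} (hw : Measurable w)
    (hw1 : ∀ x, |w x| ≤ 1) :
    ∫ z, k ((z.2 - s) / γ) * w z.1 ∂P = ∫ t in 𝒮, k ((t - s) / γ) * m w t := by
  obtain ⟨M, hM⟩ := hk.bounded
  exact hm.integral_eq w hw hw1 (fun t => k ((t - s) / γ))
    (hk.measurable.comp ((measurable_id.sub_const s).div_const γ))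
    ⟨M, fun t => by rw [abs_of_nonneg (hk.nonneg _)]; exact hM _⟩

end Bias

/-! ### Identification of the conditional means -/

section CondDistrib

variable {X : Type*} [MeasurableSpace X] {P : Measure (X × ℝ)} [IsProbabilityMeasure P] {𝒮 : Set ℝ}
  {m : (X → ℝ) → ℝ → ℝ} {L U B B₁ : ℝ}

/-- The law of the second coordinate is absolutely continuous with respect to Lebesgue measure
on `𝒮`. -/
theorem IsSmoothDisintegration.map_snd_absolutelyContinuous
    (hm : IsSmoothDisintegration P 𝒮 m L U B B₁) : P.map Prod.snd ≪ volume.restrict 𝒮 := by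
  refine Measure.AbsolutelyContinuous.mk fun N hN hN0 => ?_
  rw [Measure.map_apply measurable_snd hN]
  have h := hm.integral_eq (fun _ => 1) measurable_const (fun x => by simp) (N.indicator 1)
    (measurable_one.indicator hN) ⟨1, fun s => by
      by_cases hs : s ∈ N <;> simp [hs]⟩
  have h0 : ∫ s in 𝒮, N.indicator 1 s * m (fun _ => 1) s = 0 := by
    refine integral_eq_zero_of_ae ?_
    filter_upwards [measure_eq_zero_iff_ae_notMem.1 hN0] with s hs
    simp [hs]
  have h1 : ∫ z : X × ℝ, N.indicator (1 : ℝ → ℝ) z.2 * 1 ∂P = P.real (Prod.snd ⁻¹' N) := by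
    rw [← integral_indicator_one (measurable_snd hN)]
    refine integral_congr_ae (Eventually.of_forall fun z => ?_)
    by_cases hz : z.2 ∈ N <;> simp [hz]
  rw [h, h0] at h1
  exact (measureReal_eq_zero_iff).1 h1.symm

theorem IsSmoothDisintegration.ae_map_snd (hm : IsSmoothDisintegration P 𝒮 m L U B B₁)
    {p : ℝ → Prop} (h : ∀ᵐ s ∂(volume.restrict 𝒮), p s) : ∀ᵐ s ∂(P.map Prod.snd), p s :=
  hm.map_snd_absolutelyContinuous.ae_le h

variable {E : Type*} [MeasurableSpace E] [StandardBorelSpace E] [Nonempty E]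

theorem ae_condDistrib_mem {h : X → E} (hh : Measurable h) {A : Set E}
    (hA : MeasurableSet A) (hhA : ∀ x, h x ∈ A) :
    ∀ᵐ s ∂(P.map Prod.snd), ∀ᵐ z ∂condDistrib (fun w : X × ℝ => h w.1) Prod.snd P s, z ∈ A := by
  have hY : Measurable fun w : X × ℝ => h w.1 := hh.comp measurable_fst
  have hc : P.map Prod.snd ⊗ₘ condDistrib (fun w : X × ℝ => h w.1) Prod.snd P =
      P.map fun w => (w.2, h w.1) :=
    compProd_map_condDistrib (μ := P) (X := (Prod.snd : X × ℝ → ℝ)) hY.aemeasurable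
  have hmem : ∀ᵐ y ∂(P.map Prod.snd ⊗ₘ condDistrib (fun w : X × ℝ => h w.1) Prod.snd P),
      y.2 ∈ A := by
    rw [hc, ae_map_iff (measurable_snd.prodMk hY).aemeasurable (measurable_snd hA)]
    exact Eventually.of_forall fun w => hhA w.1
  exact Measure.ae_ae_of_ae_compProd hmem

/-- The conditional mean of `v ∘ h` given the second coordinate is the ratio of the weighted
marginal density to the marginal density. -/
theorem IsSmoothDisintegration.integral_condDistrib_eq
    (hm : IsSmoothDisintegration P 𝒮 m L U B B₁) {h : X → E} (hh : Measurable h) {A : Set E}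
    (hA : MeasurableSet A) (hhA : ∀ x, h x ∈ A) {v : E → ℝ} (hv : Measurable v)
    (hv1 : ∀ z ∈ A, |v z| ≤ 1) :
    ∀ᵐ s ∂(P.map Prod.snd), ∫ z, v z ∂condDistrib (fun w : X × ℝ => h w.1) Prod.snd P s =
      m (fun x => v (h x)) s / m (fun _ => 1) s := by
  have hprob : IsProbabilityMeasure (P.map Prod.snd) :=
    Measure.isProbabilityMeasure_map measurable_snd.aemeasurable
  set κ := condDistrib (fun w : X × ℝ => h w.1) Prod.snd P with hκ
  have hY : Measurable fun w : X × ℝ => h w.1 := hh.comp measurable_fst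
  have hc : P.map Prod.snd ⊗ₘ κ = P.map fun w => (w.2, h w.1) :=
    compProd_map_condDistrib (μ := P) (X := (Prod.snd : X × ℝ → ℝ)) hY.aemeasurable
  set w : X → ℝ := fun x => v (h x) with hw
  have hwm : Measurable w := hv.comp hh
  have hw1 : ∀ x, |w x| ≤ 1 := fun x => hv1 _ (hhA x)
  -- the ratio, truncated so as to be bounded everywhere
  set T : ℝ → ℝ := fun s => max (-1) (min 1 (m w s / m (fun _ => 1) s)) with hT
  have hTm : Measurable T :=
    measurable_const.max (measurable_const.min
      ((hm.measurable w hwm).div (hm.measurable _ measurable_const)))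
  have hTb : ∀ s, |T s| ≤ 1 := fun s =>
    _root_.abs_le.2 ⟨le_max_left _ _, max_le (by norm_num) (min_le_left _ _)⟩
  have hTeq : ∀ᵐ s ∂(volume.restrict 𝒮), T s = m w s / m (fun _ => 1) s ∧
      0 < m (fun _ => 1) s := by
    filter_upwards [hm.abs_le w hwm hw1, hm.one_mem] with s h1 h2
    have hpos : 0 < m (fun _ => 1) s := hm.L_pos.trans_le h2.1
    have h3 : |m w s / m (fun _ => 1) s| ≤ 1 := by
      rw [abs_div, abs_of_pos hpos]; exact (div_le_one hpos).2 h1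
    refine ⟨?_, hpos⟩
    rw [hT]
    simp only
    rw [min_eq_right (_root_.abs_le.1 h3).2, max_eq_right (_root_.abs_le.1 h3).1]
  have hmem := ae_condDistrib_mem (P := P) hh hA hhA
  have hfm : Measurable fun s => ∫ z, v z ∂κ s :=
    (hv.stronglyMeasurable.integral_kernel (κ := κ)).measurable
  have hfi : Integrable (fun s => ∫ z, v z ∂κ s) (P.map Prod.snd) :=
    Integrable.of_bound hfm.aestronglyMeasurable 1
      (hmem.mono fun s hs => abs_integral_le_of_ae_mem hs hv1)
  have hTi : Integrable T (P.map Prod.snd) :=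
    Integrable.of_bound hTm.aestronglyMeasurable 1 (Eventually.of_forall hTb)
  have hmain : (fun s => ∫ z, v z ∂κ s) =ᵐ[P.map Prod.snd] T := by
    refine ae_eq_of_forall_setIntegral_eq_of_sigmaFinite (fun s _ _ => hfi.integrableOn)
      (fun s _ _ => hTi.integrableOn) fun D hD _ => ?_
    set χ : ℝ → ℝ := D.indicator 1 with hχ
    have hχm : Measurable χ := measurable_one.indicator hD
    have hχ1 : ∀ s, |χ s| ≤ 1 := fun s => by
      by_cases hs : s ∈ D <;> simp [hχ, hs]
    have hset : ∀ g : ℝ → ℝ, ∫ s in D, g s ∂(P.map Prod.snd) =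
        ∫ s, χ s * g s ∂(P.map Prod.snd) := fun g => by
      rw [← integral_indicator hD]
      refine integral_congr_ae (Eventually.of_forall fun s => ?_)
      by_cases hs : s ∈ D <;> simp [hχ, hs]
    have hFm : Measurable fun y : ℝ × E => χ y.1 * v y.2 :=
      (hχm.comp measurable_fst).mul (hv.comp measurable_snd)
    have hpair : Measurable fun w : X × ℝ => (w.2, h w.1) := measurable_snd.prodMk hY
    have hFi : Integrable (fun y : ℝ × E => χ y.1 * v y.2) (P.map Prod.snd ⊗ₘ κ) := by
      rw [hc, integrable_map_measure hFm.aestronglyMeasurable hpair.aemeasurable]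
      refine Integrable.of_bound (hFm.comp hpair).aestronglyMeasurable 1
        (Eventually.of_forall fun w => ?_)
      simp only [Function.comp, Real.norm_eq_abs, abs_mul]
      exact mul_le_one₀ (hχ1 _) (abs_nonneg _) (hv1 _ (hhA _))
    rw [hset, hset]
    calc ∫ s, χ s * ∫ z, v z ∂κ s ∂(P.map Prod.snd)
        = ∫ s, ∫ z, χ s * v z ∂κ s ∂(P.map Prod.snd) := by simp_rw [integral_const_mul]
      _ = ∫ y, χ y.1 * v y.2 ∂(P.map Prod.snd ⊗ₘ κ) := (Measure.integral_compProd hFi).symm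
      _ = ∫ z, χ z.2 * w z.1 ∂P := by
          rw [hc, integral_map hpair.aemeasurable hFm.aestronglyMeasurable]
      _ = ∫ s in 𝒮, χ s * m w s := hm.integral_eq w hwm hw1 χ hχm ⟨1, hχ1⟩
      _ = ∫ s in 𝒮, (χ s * T s) * m (fun _ => 1) s := by
          refine integral_congr_ae ?_
          filter_upwards [hTeq] with s hs
          rw [hs.1, mul_assoc, div_mul_cancel₀ _ hs.2.ne']
      _ = ∫ z : X × ℝ, (χ z.2 * T z.2) * 1 ∂P :=
          (hm.integral_eq (fun _ => 1) measurable_const (fun x => by simp) (fun s => χ s * T s)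
            (hχm.mul hTm) ⟨1, fun s => by
              rw [abs_mul]; exact mul_le_one₀ (hχ1 s) (abs_nonneg _) (hTb s)⟩).symm
      _ = ∫ s, χ s * T s ∂(P.map Prod.snd) := by
          have hg : Measurable fun s => χ s * T s := hχm.mul hTm
          rw [integral_map measurable_snd.aemeasurable hg.aestronglyMeasurable]
          simp only [mul_one]
  filter_upwards [hmain, hm.ae_map_snd hTeq] with s hs1 hs2
  exact hs1.trans hs2.1

end CondDistrib

/-! ### Error of the leave-one-out estimator on a sample of fixed size -/

/-- Stability of a ratio of empirical sums: numerator and denominator are within `t` of `N` times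
their means, and the means have ratio `T` up to a bias `b`. -/
theorem abs_ratio_sub_le {W W₁ A A₁ T N t b e : ℝ} (hN : 0 < N) (he : 0 < e) (hT : |T| ≤ 1)
    (hW : |W - N * A| ≤ t) (hW₁ : |W₁ - N * A₁| ≤ t) (hb : |A - T * A₁| ≤ b) (hA₁ : e ≤ A₁)
    (ht : 2 * t ≤ N * e) : |W / W₁ - T| ≤ 4 * t / (N * e) + 2 * b / e := by
  have hNe : 0 < N * e := mul_pos hN he
  have hW₁pos : N * e / 2 ≤ W₁ := by
    have h1 := (abs_le.1 hW₁).1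
    have h2 : N * e ≤ N * A₁ := mul_le_mul_of_nonneg_left hA₁ hN.le
    linarith
  have hpos : 0 < W₁ := lt_of_lt_of_le (by positivity) hW₁pos
  have hTW : |T * (W₁ - N * A₁)| ≤ t := by
    rw [abs_mul]
    calc _ ≤ 1 * t := mul_le_mul hT hW₁ (abs_nonneg _) zero_le_one
      _ = t := one_mul t
  have hNb : |N * (A - T * A₁)| ≤ N * b := by
    rw [abs_mul, abs_of_pos hN]; exact mul_le_mul_of_nonneg_left hb hN.le
  have hnum : |W - T * W₁| ≤ 2 * t + N * b := by
    have e1 : W - T * W₁ = (W - N * A) - T * (W₁ - N * A₁) + N * (A - T * A₁) := by ring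
    rw [e1]
    have h1 := abs_add_le ((W - N * A) - T * (W₁ - N * A₁)) (N * (A - T * A₁))
    have h2 := abs_sub (W - N * A) (T * (W₁ - N * A₁))
    linarith
  have e2 : W / W₁ - T = (W - T * W₁) / W₁ := by field_simp
  rw [e2, abs_div, abs_of_pos hpos, div_le_iff₀ hpos]
  have hC : 0 ≤ 4 * t / (N * e) + 2 * b / e := by
    have h1 := (abs_nonneg _).trans hW
    have h2 := (abs_nonneg _).trans hb
    positivity
  calc |W - T * W₁| ≤ 2 * t + N * b := hnum
    _ = (4 * t / (N * e) + 2 * b / e) * (N * e / 2) := by field_simp; ring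
    _ ≤ _ := mul_le_mul_of_nonneg_left hW₁pos hC

/-- The case of the Bernstein inequality in which only a bound on the summands is known. -/
theorem pi_abs_sum_ge_le_of_bounded {W : Type*} [MeasurableSpace W] {P : Measure W}
    [IsProbabilityMeasure P] {g : W → ℝ} (hg : Measurable g) {M ℓ : ℝ} (hM : 0 < M)
    (hgM : ∀ w, |g w| ≤ M) (hℓ : 0 ≤ ℓ) {n N : ℕ} (hN : N ≤ n) (hn : 0 < n) (hℓn : ℓ ≤ n) :
    (Measure.pi fun _ : Fin N => P)
        {ω | 3 * M * √(ℓ * n) ≤ |∑ i, (g (ω i) - ∫ w, g w ∂P)|} ≤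
      2 * ENNReal.ofReal (Real.exp (-ℓ)) := by
  have hn' : (0 : ℝ) < n := by exact_mod_cast hn
  have h2 : ∫ w, g w ^ 2 ∂P ≤ M ^ 2 * 1 := by
    have hsq : ∀ w, g w ^ 2 ≤ M ^ 2 := fun w => by
      rw [← sq_abs]; exact pow_le_pow_left₀ (abs_nonneg _) (hgM w) 2
    calc _ ≤ ∫ _w, M ^ 2 ∂P := integral_mono_of_nonneg
          (Eventually.of_forall fun _ => sq_nonneg _) (integrable_const _)
          (Eventually.of_forall hsq)
      _ = M ^ 2 * 1 := by simp
  have h := pi_abs_sum_sub_integral_ge_le (ι := Fin N) hg hM (sq_nonneg M) hgM h2 hℓ (n := n)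
    (by simpa using hn') (by simpa using hℓn) one_pos (by simpa using hN)
  refine (measure_mono fun ω hω => ?_).trans h
  rw [Set.mem_ofPred_eq] at hω ⊢
  refine le_trans ?_ hω
  have e : M ^ 2 / (2 * M) = M / 2 := by field_simp
  rw [e, mul_one]
  exact mul_le_mul_of_nonneg_right (by linarith) (Real.sqrt_nonneg _)

theorem measure_biUnion_leaveOneOut_le {Ω β : Type*} [MeasurableSpace Ω] {μ : Measure Ω} {n : ℕ}
    (𝒲 : Finset β) {E : Fin n → β → Set Ω} {δ : ℝ≥0∞} (h : ∀ i, ∀ w ∈ 𝒲, μ (E i w) ≤ δ) :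
    μ (⋃ i, ⋃ w ∈ 𝒲, E i w) ≤ n * 𝒲.card * δ := by
  calc μ (⋃ i, ⋃ w ∈ 𝒲, E i w) ≤ ∑ i, μ (⋃ w ∈ 𝒲, E i w) := measure_iUnion_fintype_le _ _
    _ ≤ ∑ _i : Fin n, 𝒲.card * δ := by
        refine Finset.sum_le_sum fun i _ => (measure_biUnion_finset_le _ _).trans ?_
        refine (Finset.sum_le_sum fun w hw => h i w hw).trans ?_
        simp
    _ = n * 𝒲.card * δ := by simp [mul_assoc]

section FixedSample

variable {X : Type*} [MeasurableSpace X] {P : Measure (X × ℝ)} [IsProbabilityMeasure P] {𝒮 : Set ℝ}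
  {m : (X → ℝ) → ℝ → ℝ} {L U B B₁ : ℝ}
  {E : Type*} [MeasurableSpace E] [StandardBorelSpace E] [Nonempty E]

/-- Deviation of the kernel-weighted leave-one-out sums from their means given the excluded point.
The factor `γ` under the root comes from the second moment of the kernel weight. -/
theorem IsSmoothDisintegration.kernel_leaveOneOut_le (hm : IsSmoothDisintegration P 𝒮 m L U B B₁)
    {k : ℝ → ℝ} (hk : IsKernelProfile k) {M : ℝ} (hM0 : 0 < M) (hM : ∀ t, k t ≤ M) {γ : ℝ}
    (hγ : 0 < γ) {N : ℕ} {ℓ : ℝ} (hℓ : 0 ≤ ℓ) (hℓn : ℓ ≤ ((N + 1 : ℕ) : ℝ) * γ) (i : Fin (N + 1))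
    {w : X → ℝ} (hw : Measurable w) (hw1 : ∀ x, |w x| ≤ 1) :
    (Measure.pi fun _ : Fin (N + 1) => P)
      {ω | (2 * M + U / 2) * √(ℓ * (((N + 1 : ℕ) : ℝ) * γ)) ≤
        |∑ j ∈ Finset.univ.erase i, (k (((ω j).2 - (ω i).2) / γ) * w (ω j).1 -
          ∫ z, k ((z.2 - (ω i).2) / γ) * w z.1 ∂P)|} ≤ 2 * ENNReal.ofReal (Real.exp (-ℓ)) := by
  have hG : Measurable (Function.uncurry fun (u z : X × ℝ) => k ((z.2 - u.2) / γ) * w z.1) := by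
    refine Measurable.mul (hk.measurable.comp (Measurable.div_const (Measurable.sub ?_ ?_) γ))
      (hw.comp ?_)
    · exact measurable_snd.comp measurable_snd
    · exact measurable_snd.comp measurable_fst
    · exact measurable_fst.comp measurable_snd
  have hnγ : (0 : ℝ) < ((N + 1 : ℕ) : ℝ) * γ := by positivity
  refine pi_leaveOneOut_le hG (fun u => ?_) i
  have h := pi_abs_sum_sub_integral_ge_le (ι := Fin N) (P := P)
    (hG.comp (measurable_prodMk_left (x := u))) hM0 (mul_nonneg hM0.le hm.U_pos.le)
    (fun z => by
      simp only [Function.comp, Function.uncurry, abs_mul, abs_of_nonneg (hk.nonneg _)]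
      calc _ ≤ M * 1 := mul_le_mul (hM _) (hw1 _) (abs_nonneg _) hM0.le
        _ = M := mul_one M)
    (hm.integral_sq_kernel_le hk hM hγ u.2 hw1) hℓ hnγ hℓn hγ (by simp)
  have e : M * U / (2 * M) = U / 2 := by field_simp
  rw [e] at h
  exact h

theorem pi_leaveOneOut_of_bounded_le {N : ℕ} {ℓ : ℝ} (hℓ : 0 ≤ ℓ) (hℓn : ℓ ≤ ((N + 1 : ℕ) : ℝ))
    (i : Fin (N + 1)) {w : X → ℝ} (hw : Measurable w) (hw1 : ∀ x, |w x| ≤ 1) :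
    (Measure.pi fun _ : Fin (N + 1) => P)
      {ω | 3 * √(ℓ * ((N + 1 : ℕ) : ℝ)) ≤
        |∑ j ∈ Finset.univ.erase i, (w (ω j).1 - ∫ z, w z.1 ∂P)|} ≤
      2 * ENNReal.ofReal (Real.exp (-ℓ)) := by
  have hG : Measurable (Function.uncurry fun (_ z : X × ℝ) => w z.1) :=
    hw.comp (measurable_fst.comp measurable_snd)
  refine pi_leaveOneOut_le hG (fun u => ?_) i
  have h := pi_abs_sum_ge_le_of_bounded (P := P) (hw.comp measurable_fst)
    one_pos (fun z => hw1 z.1) hℓ (Nat.le_succ N) N.succ_pos hℓn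
  rw [mul_one] at h
  exact h

theorem sum_erase_sub_const {N : ℕ} (i : Fin (N + 1)) (f : Fin (N + 1) → ℝ) (c : ℝ) :
    ∑ j ∈ Finset.univ.erase i, (f j - c) = ∑ j ∈ Finset.univ.erase i, f j - N * c := by
  rw [Finset.sum_sub_distrib, Finset.sum_const, Finset.card_erase_of_mem (Finset.mem_univ i)]
  simp

end FixedSample

section FixedSampleError

variable {X : Type*} [MeasurableSpace X] {P : Measure (X × ℝ)} [IsProbabilityMeasure P] {𝒮 : Set ℝ}
  {m : (X → ℝ) → ℝ → ℝ} {L U B B₁ : ℝ}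

/-- Passage from a member of a net, with values `a₀` and `b₀` of the two functionals compared, to a
function within `η` of it. -/
theorem abs_sub_le_of_net {a a₀ b b₀ η τ : ℝ} (ha : |a - a₀| ≤ η) (hb : |b - b₀| ≤ η)
    (h : |a₀ - b₀| ≤ τ) : |a - b| ≤ 2 * η + τ := by
  rw [abs_le] at *
  constructor <;> linarith [ha.1, ha.2, hb.1, hb.2, h.1, h.2]

/-- Outside the exceptional events the `i`-th summand of the estimator is close to the IPM between
the conditional law at `S i` and the marginal law. -/
theorem abs_IPM_empirical_sub_le {k : ℝ → ℝ} (hk : IsKernelProfile k) {γ : ℝ} {E : Type*}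
    [MeasurableSpace E] {h : X → E} (hh : Measurable h) {A : Set E} (hhA : ∀ x, h x ∈ A)
    {V : Set (E → ℝ)} (hV : V.Nonempty)
    (hVm : ∀ v ∈ V, Measurable v ∧ ∀ z ∈ A, |v z| ≤ 1) (hA : MeasurableSet A)
    {V₀ : Finset (E → ℝ)} (hV₀ : ∀ v ∈ V₀, v ∈ V) {η : ℝ} (hη : 0 ≤ η)
    (hnet : ∀ v ∈ V, ∃ w ∈ V₀, ∀ z ∈ A, |v z - w z| ≤ η) {N : ℕ} (hN : 1 ≤ N)
    (ω : Fin (N + 1) → X × ℝ) (i : Fin (N + 1)) {e t b r : ℝ} (he : 0 < e) (κ : Measure E)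
    [IsProbabilityMeasure κ] (hκ : ∀ᵐ z ∂κ, z ∈ A)
    (hmass : e ≤ ∫ z, k ((z.2 - (ω i).2) / γ) * 1 ∂P)
    (hbias : ∀ v ∈ V₀, |∫ z, k ((z.2 - (ω i).2) / γ) * v (h z.1) ∂P -
      (∫ z, v z ∂κ) * ∫ z, k ((z.2 - (ω i).2) / γ) * 1 ∂P| ≤ b)
    (ht : 2 * t ≤ N * e)
    (hden : |∑ j ∈ Finset.univ.erase i, (k (((ω j).2 - (ω i).2) / γ) * 1 -
      ∫ z, k ((z.2 - (ω i).2) / γ) * 1 ∂P)| ≤ t)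
    (hnum : ∀ v ∈ V₀, |∑ j ∈ Finset.univ.erase i, (k (((ω j).2 - (ω i).2) / γ) * v (h (ω j).1) -
      ∫ z, k ((z.2 - (ω i).2) / γ) * v (h z.1) ∂P)| ≤ t)
    (hmarg : ∀ v ∈ V₀, |∑ j ∈ Finset.univ.erase i, (v (h (ω j).1) - ∫ z, v (h z.1) ∂P)| ≤ r) :
    |IPM V (condEmpirical k γ (fun j => h (ω j).1) (fun j => (ω j).2) i)
          (margEmpirical (fun j => h (ω j).1) i) -
        IPM V κ (P.map fun w => h w.1)| ≤
      (2 * η + (4 * t / (N * e) + 2 * b / e)) + (2 * η + r / N) := by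
  have hN0 : (0 : ℝ) < N := by exact_mod_cast hN
  have hY : Measurable fun w : X × ℝ => h w.1 := hh.comp measurable_fst
  have hprob : IsProbabilityMeasure (P.map fun w => h w.1) :=
    Measure.isProbabilityMeasure_map hY.aemeasurable
  have hQ : ∀ᵐ z ∂(P.map fun w : X × ℝ => h w.1), z ∈ A := 
    (ae_map_iff hY.aemeasurable (p := fun z => z ∈ A) hA).2 (Eventually.of_forall fun w => hhA w.1)
  have hbound : ∀ v ∈ V, ∀ j, |v (h (ω j).1)| ≤ 1 := fun v hv j => (hVm v hv).2 _ (hhA _)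
  refine abs_IPM_sub_IPM_le (C := 2) hV ?_ ?_ ?_ ?_
  · intro v hv
    have h1 := abs_integral_condEmpirical_le hk γ (fun j => h (ω j).1) (fun j => (ω j).2) i
      (hVm v hv).1 zero_le_one (hbound v hv)
    have h2 := abs_integral_margEmpirical_le (fun j => h (ω j).1) i (hVm v hv).1 zero_le_one
      (hbound v hv)
    refine (abs_sub _ _).trans ?_
    linarith
  · intro v hv
    have h1 := abs_integral_le_of_ae_mem hκ (hVm v hv).2
    have h2 := abs_integral_le_of_ae_mem hQ (hVm v hv).2
    refine (abs_sub _ _).trans ?_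
    linarith
  · intro v hv
    obtain ⟨w, hw, hvw⟩ := hnet v hv
    have hwV := hVm w (hV₀ w hw)
    refine abs_sub_le_of_net
      (abs_integral_condEmpirical_sub_le hk γ (fun j => h (ω j).1) (fun j => (ω j).2) i
        (hVm v hv).1 hwV.1 hη fun j => hvw _ (hhA _))
      (abs_integral_sub_integral_le_of_ae_mem hκ (hVm v hv).1 hwV.1 (hVm v hv).2 hwV.2 hvw) ?_
    have h1 := hnum w hw
    have h2 := hden
    rw [sum_erase_sub_const] at h1 h2
    have h3 := abs_ratio_sub_le hN0 he (abs_integral_le_of_ae_mem hκ hwV.2) h1 h2 (hbias w hw)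
      hmass ht
    rw [integral_condEmpirical hk.nonneg γ _ _ i hwV.1]
    simpa only [mul_one] using h3
  · intro v hv
    obtain ⟨w, hw, hvw⟩ := hnet v hv
    have hwV := hVm w (hV₀ w hw)
    refine abs_sub_le_of_net
      (abs_integral_margEmpirical_sub_le (fun j => h (ω j).1) i (hVm v hv).1 hwV.1 hη
        fun j => hvw _ (hhA _))
      (abs_integral_sub_integral_le_of_ae_mem hQ (hVm v hv).1 hwV.1 (hVm v hv).2 hwV.2 hvw) ?_
    have h1 := hmarg w hw
    rw [sum_erase_sub_const] at h1
    rw [integral_margEmpirical (by omega) _ i hwV.1,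
      integral_map hY.aemeasurable hwV.1.aestronglyMeasurable]
    have e1 : (((N + 1 : ℕ) : ℝ) - 1) = N := by push_cast; ring
    rw [e1]
    have e2 : (∑ j ∈ Finset.univ.erase i, w (h (ω j).1)) / (N : ℝ) - ∫ z, w (h z.1) ∂P =
        (∑ j ∈ Finset.univ.erase i, w (h (ω j).1) - N * ∫ z, w (h z.1) ∂P) / N := by
      field_simp
    rw [e2, abs_div, abs_of_pos hN0]
    exact div_le_div_of_nonneg_right h1 hN0.le

variable {E : Type*} [MeasurableSpace E] [StandardBorelSpace E] [Nonempty E]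

/-- What the error bound needs of the conditioning value `s`: the conditional law lives on `A`, and
for the finitely many discriminators of the net the kernel averages have ratio close to the
conditional mean. -/
theorem IsSmoothDisintegration.ae_condDistrib_bias_le
    (hm : IsSmoothDisintegration P 𝒮 m L U B B₁) (h𝒮 : MeasurableSet 𝒮) {k : ℝ → ℝ}
    (hk : IsKernelProfile k) {γ : ℝ} (hγ : 0 < γ)
    (hmass : ∀ s ∈ 𝒮, γ / 4 ≤ ∫ t in 𝒮, k ((t - s) / γ)) {h : X → E} (hh : Measurable h)
    {A : Set E} (hA : MeasurableSet A) (hhA : ∀ x, h x ∈ A) (V₀ : Finset (E → ℝ))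
    (hV₀ : ∀ v ∈ V₀, Measurable v ∧ ∀ z ∈ A, |v z| ≤ 1) :
    ∀ᵐ s ∂(P.map Prod.snd),
      (∀ᵐ z ∂condDistrib (fun w : X × ℝ => h w.1) Prod.snd P s, z ∈ A) ∧
      L / 4 * γ ≤ ∫ z, k ((z.2 - s) / γ) * 1 ∂P ∧
      ∀ v ∈ V₀, |∫ z, k ((z.2 - s) / γ) * v (h z.1) ∂P -
          (∫ z, v z ∂condDistrib (fun w : X × ℝ => h w.1) Prod.snd P s) *
            ∫ z, k ((z.2 - s) / γ) * 1 ∂P| ≤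
        2 * B * (γ ^ 3 * ∫ u, u ^ 2 * k u) + 2 * B₁ * boundaryMoment k γ 𝒮 s := by
  have h1m : Measurable fun _ : X => (1 : ℝ) := measurable_const
  have h11 : ∀ x : X, |(fun _ : X => (1 : ℝ)) x| ≤ 1 := fun x => by simp
  have hV : ∀ v ∈ V₀, ∀ᵐ s ∂(P.map Prod.snd), |∫ z, k ((z.2 - s) / γ) * v (h z.1) ∂P -
      (∫ z, v z ∂condDistrib (fun w : X × ℝ => h w.1) Prod.snd P s) *
        ∫ z, k ((z.2 - s) / γ) * 1 ∂P| ≤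
      2 * B * (γ ^ 3 * ∫ u, u ^ 2 * k u) + 2 * B₁ * boundaryMoment k γ 𝒮 s := by
    intro v hv
    have hwm : Measurable fun x => v (h x) := (hV₀ v hv).1.comp hh
    have hw1 : ∀ x, |v (h x)| ≤ 1 := fun x => (hV₀ v hv).2 _ (hhA x)
    filter_upwards [hm.ae_map_snd (hm.abs_kernel_bias_le h𝒮 hk hγ hwm hw1),
      hm.integral_condDistrib_eq hh hA hhA (hV₀ v hv).1 (hV₀ v hv).2] with s hs1 hs2
    rw [hs2, hm.integral_kernel_mul_eq hk γ s hwm hw1, hm.integral_kernel_mul_eq hk γ s h1m h11]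
    exact hs1
  filter_upwards [ae_condDistrib_mem (P := P) hh hA hhA,
    hm.ae_map_snd (ae_restrict_mem h𝒮), (ae_ball_iff V₀.countable_toSet).2 hV] with s hs1 hs2 hs3
  refine ⟨hs1, ?_, hs3⟩
  rw [hm.integral_kernel_mul_eq hk γ s h1m h11]
  exact hm.kernel_mass_ge hk hγ (hmass s hs2)

end FixedSampleError

/-- The stochastic, bias and boundary terms of the `n` summands, averaged. Here `σ` stands for
`√(ℓ n)` and `ρ` for `√(ℓ / (n γ))`, and `x i`, `F i`, `g i` for the `i`-th summand of the
estimator, the `i`-th population IPM, and the `i`-th normalized boundary moment. -/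
theorem abs_average_sub_le {N : ℕ} (hN : 1 ≤ N) {x F g : Fin (N + 1) → ℝ}
    {η C₁ L γ ρ σ B B₁ U κ₁ κ₂ G I : ℝ} (hC₁ : 0 ≤ C₁) (hL : 0 < L) (hγ : 0 < γ) (hγ1 : γ ≤ 1)
    (hρ : 0 ≤ ρ) (hσ : σ ≤ ((N + 1 : ℕ) : ℝ) * ρ) (hB₁ : 0 ≤ B₁) (hκ₁ : 0 ≤ κ₁)
    (hx : ∀ i, |x i - F i| ≤
      (2 * η + (4 * (C₁ * (((N + 1 : ℕ) : ℝ) * γ * ρ)) / (N * (L / 4 * γ)) +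
        2 * (2 * B * (γ ^ 3 * κ₂) + 2 * B₁ * (γ ^ 2 * g i)) / (L / 4 * γ))) +
          (2 * η + 3 * σ / N))
    (hF : |∑ i, (F i - I)| ≤ 6 * σ) (hg : |∑ i, (g i - G)| ≤ 3 * (κ₁ + 1) * σ)
    (hG : G ≤ U * (γ * κ₂)) :
    |1 / ((N + 1 : ℕ) : ℝ) * ∑ i, x i - I| ≤
      4 * η + (32 * C₁ / L + 12 + 48 * B₁ * (κ₁ + 1) / L) * ρ +
        16 * (B + B₁ * U) * κ₂ / L * γ ^ 2 := by
  have hN0 : (0 : ℝ) < N := by exact_mod_cast hN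
  have hN1 : (1 : ℝ) ≤ N := by exact_mod_cast hN
  set n : ℝ := ((N + 1 : ℕ) : ℝ) with hn
  have hnN : n = N + 1 := by rw [hn]; push_cast; ring
  have hn0 : 0 < n := by rw [hnN]; linarith
  have hn2 : n / N ≤ 2 := by rw [div_le_iff₀ hN0, hnN]; linarith
  have hcard : ∀ c : ℝ, ∑ _i : Fin (N + 1), c = n * c := fun c => by simp [hn]
  set c₀ : ℝ := 4 * η + 32 * C₁ / L * ρ + 6 * ρ + 16 * B * κ₂ / L * γ ^ 2 with hc₀
  have hxi : ∀ i, |x i - F i| ≤ c₀ + 16 * B₁ * γ / L * g i := by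
    intro i
    refine (hx i).trans ?_
    have h1 : 4 * (C₁ * (n * γ * ρ)) / (N * (L / 4 * γ)) = 16 * C₁ / L * ρ * (n / N) := by
      field_simp; ring
    have h2 : 2 * (2 * B * (γ ^ 3 * κ₂) + 2 * B₁ * (γ ^ 2 * g i)) / (L / 4 * γ) =
        16 * B * κ₂ / L * γ ^ 2 + 16 * B₁ * γ / L * g i := by
      field_simp; ring
    have h3 : 3 * σ / N ≤ 6 * ρ := by
      rw [div_le_iff₀ hN0]
      have : n ≤ 2 * N := by rw [hnN]; linarith
      nlinarith
    have h4 : 16 * C₁ / L * ρ * (n / N) ≤ 16 * C₁ / L * ρ * 2 :=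
      mul_le_mul_of_nonneg_left hn2 (by positivity)
    rw [h1, h2, hc₀]
    have h5 : 16 * C₁ / L * ρ * 2 = 32 * C₁ / L * ρ := by ring
    linarith
  have hsum : |∑ i, (x i - F i)| ≤ n * c₀ + 16 * B₁ * γ / L * ∑ i, g i := by
    calc |∑ i, (x i - F i)| ≤ ∑ i, |x i - F i| := Finset.abs_sum_le_sum_abs _ _
      _ ≤ ∑ i, (c₀ + 16 * B₁ * γ / L * g i) := Finset.sum_le_sum fun i _ => hxi i
      _ = n * c₀ + 16 * B₁ * γ / L * ∑ i, g i := by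
          rw [Finset.sum_add_distrib, hcard, Finset.mul_sum]
  have hgs : ∑ i, g i ≤ n * (U * (γ * κ₂)) + 3 * (κ₁ + 1) * (n * ρ) := by
    rw [Finset.sum_sub_distrib, hcard] at hg
    have h1 := (abs_le.1 hg).2
    have h2 : n * G ≤ n * (U * (γ * κ₂)) := mul_le_mul_of_nonneg_left hG hn0.le
    have h3 : 3 * (κ₁ + 1) * σ ≤ 3 * (κ₁ + 1) * (n * ρ) :=
      mul_le_mul_of_nonneg_left hσ (by positivity)
    linarith
  have hgs' : 16 * B₁ * γ / L * ∑ i, g i ≤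
      n * (16 * B₁ * U * κ₂ / L * γ ^ 2 + 48 * B₁ * (κ₁ + 1) / L * ρ) := by
    have h1 : 16 * B₁ * γ / L * ∑ i, g i ≤
        16 * B₁ * γ / L * (n * (U * (γ * κ₂)) + 3 * (κ₁ + 1) * (n * ρ)) :=
      mul_le_mul_of_nonneg_left hgs (by positivity)
    have h2 : 16 * B₁ * γ / L * (n * (U * (γ * κ₂)) + 3 * (κ₁ + 1) * (n * ρ)) =
        n * (16 * B₁ * U * κ₂ / L * γ ^ 2 + 48 * B₁ * (κ₁ + 1) / L * ρ * γ) := by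
      field_simp; ring
    have h3 : 48 * B₁ * (κ₁ + 1) / L * ρ * γ ≤ 48 * B₁ * (κ₁ + 1) / L * ρ * 1 :=
      mul_le_mul_of_nonneg_left hγ1 (by positivity)
    have h4 := mul_le_mul_of_nonneg_left h3 hn0.le
    linarith
  have hdecomp : 1 / n * ∑ i, x i - I = (∑ i, (x i - F i) + ∑ i, (F i - I)) / n := by
    rw [Finset.sum_sub_distrib, Finset.sum_sub_distrib, hcard]
    field_simp; ring
  rw [hdecomp, abs_div, abs_of_pos hn0, div_le_iff₀ hn0]
  refine (abs_add_le _ _).trans ?_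
  have h6 : n * c₀ + n * (16 * B₁ * U * κ₂ / L * γ ^ 2 + 48 * B₁ * (κ₁ + 1) / L * ρ) +
      6 * (n * ρ) = (4 * η + (32 * C₁ / L + 12 + 48 * B₁ * (κ₁ + 1) / L) * ρ +
        16 * (B + B₁ * U) * κ₂ / L * γ ^ 2) * n := by
    rw [hc₀]; ring
  linarith

section FixedSampleBound

variable {X : Type*} [MeasurableSpace X] {P : Measure (X × ℝ)} [IsProbabilityMeasure P] {𝒮 : Set ℝ}
  {m : (X → ℝ) → ℝ → ℝ} {L U B B₁ : ℝ}
  {E : Type*} [MeasurableSpace E] [StandardBorelSpace E] [Nonempty E]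

theorem ae_EIPM_integrand_le {h : X → E} (hh : Measurable h) {A : Set E} (hA : MeasurableSet A)
    (hhA : ∀ x, h x ∈ A) {V : Set (E → ℝ)} (hV : V.Nonempty)
    (hVm : ∀ v ∈ V, Measurable v ∧ ∀ z ∈ A, |v z| ≤ 1) :
    ∀ᵐ s ∂(P.map Prod.snd),
      |IPM V (condDistrib (fun w : X × ℝ => h w.1) Prod.snd P s) (P.map fun w => h w.1)| ≤ 2 := by
  have hY : Measurable fun w : X × ℝ => h w.1 := hh.comp measurable_fst
  have hprob : IsProbabilityMeasure (P.map fun w => h w.1) :=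
    Measure.isProbabilityMeasure_map hY.aemeasurable
  have hQ : ∀ᵐ z ∂(P.map fun w : X × ℝ => h w.1), z ∈ A :=
    (ae_map_iff hY.aemeasurable (p := fun z => z ∈ A) hA).2 (Eventually.of_forall fun w => hhA w.1)
  filter_upwards [ae_condDistrib_mem (P := P) hh hA hhA] with s hs
  rw [abs_of_nonneg (IPM_nonneg _ _ _)]
  refine IPM_le hV fun v hv => ?_
  have h1 := abs_integral_le_of_ae_mem hs (hVm v hv).2
  have h2 := abs_integral_le_of_ae_mem hQ (hVm v hv).2
  refine (abs_sub _ _).trans ?_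
  linarith

/-- Without any concentration the error is at most `4`. -/
theorem abs_EIPMhat_sub_EIPM_le {k : ℝ → ℝ} (hk : IsKernelProfile k) (γ : ℝ) {h : X → E}
    (hh : Measurable h) {A : Set E} (hA : MeasurableSet A)
    (hhA : ∀ x, h x ∈ A) {V : Set (E → ℝ)} (hV : V.Nonempty)
    (hVm : ∀ v ∈ V, Measurable v ∧ ∀ z ∈ A, |v z| ≤ 1) {N : ℕ} (ω : Fin (N + 1) → X × ℝ) :
    |EIPMhat V k γ (fun i => h (ω i).1) (fun i => (ω i).2) -
      EIPM V (fun w : X × ℝ => h w.1) Prod.snd P| ≤ 4 := by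
  have hprob : IsProbabilityMeasure (P.map Prod.snd) :=
    Measure.isProbabilityMeasure_map measurable_snd.aemeasurable
  have h1 : |EIPM V (fun w : X × ℝ => h w.1) Prod.snd P| ≤ 2 := by
    have := norm_integral_le_of_norm_le_const (C := 2) (μ := P.map Prod.snd)
      (f := fun s => IPM V (condDistrib (fun w : X × ℝ => h w.1) Prod.snd P s)
        (P.map fun w => h w.1))
      ((ae_EIPM_integrand_le (P := P) hh hA hhA hV hVm).mono fun s hs => by
        rwa [Real.norm_eq_abs])
    simpa [EIPM] using this
  have h2 : |EIPMhat V k γ (fun i => h (ω i).1) (fun i => (ω i).2)| ≤ 2 := by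
    have hi : ∀ i, |IPM V (condEmpirical k γ (fun i => h (ω i).1) (fun i => (ω i).2) i)
        (margEmpirical (fun i => h (ω i).1) i)| ≤ 2 := fun i => by
      rw [abs_of_nonneg (IPM_nonneg _ _ _)]
      refine IPM_le hV fun v hv => ?_
      have hb : ∀ j, |v (h (ω j).1)| ≤ 1 := fun j => (hVm v hv).2 _ (hhA _)
      have h3 := abs_integral_condEmpirical_le hk γ (fun j => h (ω j).1) (fun j => (ω j).2) i
        (hVm v hv).1 zero_le_one hb
      have h4 := abs_integral_margEmpirical_le (fun j => h (ω j).1) i (hVm v hv).1 zero_le_one hb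
      refine (abs_sub _ _).trans ?_
      linarith
    have hn : (0 : ℝ) < ((N + 1 : ℕ) : ℝ) := by positivity
    rw [EIPMhat, abs_mul, abs_of_pos (by positivity : (0 : ℝ) < 1 / ((N + 1 : ℕ) : ℝ))]
    calc _ ≤ 1 / ((N + 1 : ℕ) : ℝ) * ∑ _i : Fin (N + 1), (2 : ℝ) :=
          mul_le_mul_of_nonneg_left ((Finset.abs_sum_le_sum_abs _ _).trans
            (Finset.sum_le_sum fun i _ => hi i)) (by positivity)
      _ = 2 := by simp; field_simp
  refine (abs_sub _ _).trans ?_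
  linarith

set_option maxHeartbeats 1000000 in
/-- The error bound for a fixed sample size, a finite net of the class, and a confidence level
`ℓ` that is small compared with `n γ`. -/
theorem IsSmoothDisintegration.pi_not_abs_EIPMhat_sub_le
    (hm : IsSmoothDisintegration P 𝒮 m L U B B₁) (h𝒮 : 𝒮.OrdConnected) {D : ℝ}
    (hD : ∀ s ∈ 𝒮, ∀ t ∈ 𝒮, |t - s| ≤ D) {k : ℝ → ℝ} (hk : IsKernelProfile k) {M : ℝ} (hM0 : 0 < M)
    (hM : ∀ t, k t ≤ M) {γ : ℝ} (hγ : 0 < γ) (hγ1 : γ ≤ 1)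
    (hmass : ∀ s ∈ 𝒮, γ / 4 ≤ ∫ t in 𝒮, k ((t - s) / γ)) {h : X → E} (hh : Measurable h)
    {A : Set E} (hA : MeasurableSet A) (hhA : ∀ x, h x ∈ A) {V : Set (E → ℝ)} (hV : V.Nonempty)
    (hVm : ∀ v ∈ V, Measurable v ∧ ∀ z ∈ A, |v z| ≤ 1)
    (hF : AEMeasurable (fun s => IPM V (condDistrib (fun w : X × ℝ => h w.1) Prod.snd P s)
      (P.map fun w => h w.1)) (P.map Prod.snd))
    {V₀ : Finset (E → ℝ)} (hV₀ : ∀ v ∈ V₀, v ∈ V) {η : ℝ} (hη : 0 ≤ η)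
    (hnet : ∀ v ∈ V, ∃ w ∈ V₀, ∀ z ∈ A, |v z - w z| ≤ η) {N : ℕ} (hN : 1 ≤ N) {ℓ : ℝ} (hℓ : 0 ≤ ℓ)
    (hℓn : ℓ ≤ ((N + 1 : ℕ) : ℝ) * γ)
    (hreg : 16 * (2 * M + U / 2) * √(ℓ / (((N + 1 : ℕ) : ℝ) * γ)) ≤ L) :
    (Measure.pi fun _ : Fin (N + 1) => P)
      {ω | ¬ |EIPMhat V k γ (fun i => h (ω i).1) (fun i => (ω i).2) -
          EIPM V (fun w : X × ℝ => h w.1) Prod.snd P| ≤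
        4 * η + (32 * (2 * M + U / 2) / L + 12 + 48 * B₁ * ((∫ u, k u * |u|) + 1) / L) *
          √(ℓ / (((N + 1 : ℕ) : ℝ) * γ)) +
          16 * (B + B₁ * U) * (∫ u, u ^ 2 * k u) / L * γ ^ 2} ≤
      (((N + 1 : ℕ) : ℝ≥0∞) * (2 * V₀.card + 1) + 2) * (2 * ENNReal.ofReal (Real.exp (-ℓ))) := by
  have hprob : IsProbabilityMeasure (P.map Prod.snd) :=
    Measure.isProbabilityMeasure_map measurable_snd.aemeasurable
  have hN1 : (1 : ℝ) ≤ N := by exact_mod_cast hN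
  set n : ℝ := ((N + 1 : ℕ) : ℝ) with hn
  have hnN : n = N + 1 := by rw [hn]; push_cast; ring
  have hn0 : 0 < n := by rw [hnN]; linarith
  have hnγ : 0 < n * γ := mul_pos hn0 hγ
  set ρ := √(ℓ / (n * γ)) with hρ
  have hρ0 : 0 ≤ ρ := Real.sqrt_nonneg _
  set κ₁ := ∫ u, k u * |u| with hκ₁
  set κ₂ := ∫ u, u ^ 2 * k u with hκ₂
  have hκ₁0 : 0 ≤ κ₁ := integral_nonneg fun u => mul_nonneg (hk.nonneg u) (abs_nonneg u)
  set C₁ := 2 * M + U / 2 with hC₁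
  have hC₁0 : 0 ≤ C₁ := by have := hm.U_pos; positivity
  have hL := hm.L_pos
  have hsqrt : √(ℓ * (n * γ)) = n * γ * ρ := by
    rw [hρ, ← Real.sqrt_sq hnγ.le, ← Real.sqrt_mul (sq_nonneg _), Real.sqrt_sq hnγ.le]
    congr 1; field_simp
  have hσρ : √(ℓ * n) ≤ n * ρ := by
    rw [hρ, ← Real.sqrt_sq hn0.le, ← Real.sqrt_mul (sq_nonneg _), Real.sqrt_sq hn0.le]
    refine Real.sqrt_le_sqrt ?_
    have e : n ^ 2 * (ℓ / (n * γ)) = ℓ * n / γ := by field_simp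
    rw [e, le_div_iff₀ hγ]
    exact mul_le_of_le_one_right (by positivity) hγ1
  have hℓn' : ℓ ≤ n := hℓn.trans (mul_le_of_le_one_right hn0.le hγ1)
  -- the population IPM, modified on a null set so as to be measurable and bounded
  set F : ℝ → ℝ := fun s => IPM V (condDistrib (fun w : X × ℝ => h w.1) Prod.snd P s)
    (P.map fun w => h w.1) with hFdef
  set F' : ℝ → ℝ := fun s => max (-2) (min 2 (hF.mk F s)) with hF'
  have hF'm : Measurable F' :=
    measurable_const.max (measurable_const.min hF.measurable_mk)
  have hF'b : ∀ s, |F' s| ≤ 2 := fun s =>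
    _root_.abs_le.2 ⟨le_max_left _ _, max_le (by norm_num) (min_le_left _ _)⟩
  have hFF' : ∀ᵐ s ∂(P.map Prod.snd), F s = F' s := by
    filter_upwards [hF.ae_eq_mk, ae_EIPM_integrand_le (P := P) hh hA hhA hV hVm] with s hs1 hs2
    have h3 : |F s| ≤ 2 := hs2
    simp only [hF', ← hs1]
    rw [min_eq_right (_root_.abs_le.1 h3).2, max_eq_right (_root_.abs_le.1 h3).1]
  have hEIPM : EIPM V (fun w : X × ℝ => h w.1) Prod.snd P = ∫ z : X × ℝ, F' z.2 ∂P := by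
    rw [EIPM, integral_congr_ae hFF', integral_map measurable_snd.aemeasurable
      hF'm.aestronglyMeasurable]
  -- the normalized boundary moment
  set g : ℝ → ℝ := fun s => boundaryMoment k γ 𝒮 s / γ ^ 2 with hg
  have hgm : Measurable g := (measurable_boundaryMoment hk).div_const _
  have hγ2 : 0 < γ ^ 2 := by positivity
  have hg0 : ∀ s, 0 ≤ g s := fun s => div_nonneg (boundaryMoment_nonneg hk s) hγ2.le
  have hgb : ∀ s, |g s| ≤ κ₁ + 1 := fun s => by
    rw [abs_of_nonneg (hg0 s), hg]
    simp only
    rw [div_le_iff₀ hγ2]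
    have := boundaryMoment_le (𝒮 := 𝒮) hk hγ s
    nlinarith
  have hgG : ∫ z : X × ℝ, g z.2 ∂P ≤ U * (γ * κ₂) := by
    have hfin : volume 𝒮 ≠ ⊤ := by
      refine (Bornology.IsBounded.measure_lt_top (Metric.isBounded_iff.2 ⟨D, ?_⟩)).ne
      exact fun s hs t ht => by rw [dist_comm, Real.dist_eq]; exact hD s hs t ht
    refine (hm.integral_snd_le hgm hg0 ⟨_, hgb⟩ (Measure.integrableOn_of_bounded hfin
      hgm.aestronglyMeasurable (Eventually.of_forall hgb))).trans ?_
    refine mul_le_mul_of_nonneg_left ?_ hm.U_pos.le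
    rw [hg, integral_div, div_le_iff₀ hγ2]
    refine (setIntegral_boundaryMoment_le hk hγ h𝒮 hD).trans (le_of_eq ?_)
    ring
  -- the exceptional events
  set E₁ : Fin (N + 1) → (E → ℝ) → Set (Fin (N + 1) → X × ℝ) := fun i v =>
    {ω | C₁ * √(ℓ * (n * γ)) ≤
      |∑ j ∈ Finset.univ.erase i, (k (((ω j).2 - (ω i).2) / γ) * v (h (ω j).1) -
        ∫ z, k ((z.2 - (ω i).2) / γ) * v (h z.1) ∂P)|} with hE₁
  set E₂ : Fin (N + 1) → Unit → Set (Fin (N + 1) → X × ℝ) := fun i _ =>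
    {ω | C₁ * √(ℓ * (n * γ)) ≤
      |∑ j ∈ Finset.univ.erase i, (k (((ω j).2 - (ω i).2) / γ) * 1 -
        ∫ z, k ((z.2 - (ω i).2) / γ) * 1 ∂P)|} with hE₂
  set E₃ : Fin (N + 1) → (E → ℝ) → Set (Fin (N + 1) → X × ℝ) := fun i v =>
    {ω | 3 * √(ℓ * n) ≤
      |∑ j ∈ Finset.univ.erase i, (v (h (ω j).1) - ∫ z, v (h z.1) ∂P)|} with hE₃
  set E₄ : Set (Fin (N + 1) → X × ℝ) :=
    {ω | 3 * 2 * √(ℓ * n) ≤ |∑ i, (F' (ω i).2 - ∫ z, F' z.2 ∂P)|} with hE₄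
  set E₅ : Set (Fin (N + 1) → X × ℝ) :=
    {ω | 3 * (κ₁ + 1) * √(ℓ * n) ≤ |∑ i, (g (ω i).2 - ∫ z, g z.2 ∂P)|} with hE₅
  set δ : ℝ≥0∞ := 2 * ENNReal.ofReal (Real.exp (-ℓ)) with hδ
  have hvm : ∀ v ∈ V₀, Measurable (fun x => v (h x)) ∧ ∀ x, |v (h x)| ≤ 1 := fun v hv =>
    ⟨(hVm v (hV₀ v hv)).1.comp hh, fun x => (hVm v (hV₀ v hv)).2 _ (hhA x)⟩
  have m₁ := measure_biUnion_leaveOneOut_le (μ := Measure.pi fun _ : Fin (N + 1) => P) V₀ (E := E₁)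
    (δ := δ) fun i v hv =>
      hm.kernel_leaveOneOut_le hk hM0 hM hγ hℓ hℓn i (hvm v hv).1 (hvm v hv).2
  have m₂ := measure_biUnion_leaveOneOut_le (μ := Measure.pi fun _ : Fin (N + 1) => P)
    (Finset.univ : Finset Unit) (E := E₂) (δ := δ) fun i _ _ =>
      hm.kernel_leaveOneOut_le hk hM0 hM hγ hℓ hℓn i (w := fun _ => 1) measurable_const
        (fun x => by simp)
  have m₃ := measure_biUnion_leaveOneOut_le (μ := Measure.pi fun _ : Fin (N + 1) => P) V₀ (E := E₃)
    (δ := δ) fun i v hv => pi_leaveOneOut_of_bounded_le hℓ hℓn' i (hvm v hv).1 (hvm v hv).2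
  have m₄ : (Measure.pi fun _ : Fin (N + 1) => P) E₄ ≤ δ :=
    pi_abs_sum_ge_le_of_bounded (hF'm.comp measurable_snd) two_pos (fun z => hF'b z.2) hℓ le_rfl
      N.succ_pos hℓn'
  have m₅ : (Measure.pi fun _ : Fin (N + 1) => P) E₅ ≤ δ :=
    pi_abs_sum_ge_le_of_bounded (hgm.comp measurable_snd) (by positivity) (fun z => hgb z.2) hℓ
      le_rfl N.succ_pos hℓn'
  have hae : ∀ᵐ ω ∂(Measure.pi fun _ : Fin (N + 1) => P), ∀ i, _ := ae_all_iff.2 fun i =>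
    (Measure.quasiMeasurePreserving_eval (fun _ : Fin (N + 1) => P) i).ae
      (ae_of_ae_map measurable_snd.aemeasurable (hFF'.and
        (hm.ae_condDistrib_bias_le h𝒮.measurableSet hk hγ hmass hh hA hhA V₀
          fun v hv => hVm v (hV₀ v hv))))
  have hsub : ∀ᵐ ω ∂(Measure.pi fun _ : Fin (N + 1) => P),
      (¬ |EIPMhat V k γ (fun i => h (ω i).1) (fun i => (ω i).2) -
          EIPM V (fun w : X × ℝ => h w.1) Prod.snd P| ≤
        4 * η + (32 * C₁ / L + 12 + 48 * B₁ * (κ₁ + 1) / L) * ρ +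
          16 * (B + B₁ * U) * κ₂ / L * γ ^ 2) →
      ω ∈ (⋃ i, ⋃ v ∈ V₀, E₁ i v) ∪ (⋃ i, ⋃ u ∈ (Finset.univ : Finset Unit), E₂ i u) ∪
        (⋃ i, ⋃ v ∈ V₀, E₃ i v) ∪ E₄ ∪ E₅ := by
    filter_upwards [hae] with ω hω
    contrapose!
    intro hout
    simp only [Set.mem_union, Set.mem_iUnion, not_or, not_exists, hE₁, hE₂, hE₃, hE₄, hE₅,
      Set.mem_ofPred_eq, not_le] at hout
    obtain ⟨⟨⟨⟨o₁, o₂⟩, o₃⟩, o₄⟩, o₅⟩ := hout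
    rw [hEIPM, EIPMhat]
    refine abs_average_sub_le hN (F := fun i => F' (ω i).2) (g := fun i => g (ω i).2)
      (σ := √(ℓ * n)) hC₁0 hL hγ hγ1 hρ0 hσρ hm.B₁_nonneg hκ₁0 ?_ ?_ o₅.le hgG
    · intro i
      obtain ⟨e1, e2, e3, e4⟩ := hω i
      have e0 : F (ω i).2 = F' (ω i).2 := e1
      rw [← e0, ← hsqrt]
      refine abs_IPM_empirical_sub_le hk hh hhA hV hVm hA hV₀ hη hnet hN ω i (by positivity) _
        e2 e3 (fun v hv => ?_) ?_ (o₂ i () (Finset.mem_univ _)).le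
        (fun v hv => (o₁ i v hv).le) (fun v hv => (o₃ i v hv).le)
      · have e5 : γ ^ 2 * g (ω i).2 = boundaryMoment k γ 𝒮 (ω i).2 := by
          simp only [hg]; field_simp
        rw [e5]
        exact e4 v hv
      · rw [hsqrt]
        have e6 : n ≤ 2 * N := by rw [hnN]; linarith
        have e7 : 2 * (C₁ * (n * γ * ρ)) ≤ 2 * (C₁ * (2 * N * γ * ρ)) := by gcongr
        have e8 : N * γ / 4 * (16 * C₁ * ρ) ≤ N * γ / 4 * L :=
          mul_le_mul_of_nonneg_left hreg (by positivity)
        linarith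
    · have : (3 : ℝ) * 2 = 6 := by norm_num
      rw [this] at o₄
      exact o₄.le
  refine (measure_mono_ae hsub).trans ?_
  refine (measure_union_le _ _).trans (le_trans (add_le_add ((measure_union_le _ _).trans
    (add_le_add ((measure_union_le _ _).trans (add_le_add ((measure_union_le _ _).trans
      (add_le_add m₁ m₂)) m₃)) m₄)) m₅) (le_of_eq ?_))
  simp only [Finset.card_univ, Fintype.card_unit, Nat.cast_one]
  ring

end FixedSampleBound

/-! ### Choice of the confidence level and comparison with the rate -/

/-- At the level `ℓ = 3 log n + log K` the union bound over the exceptional events is below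
`4 / n`. -/
theorem union_bound_le {N K c : ℕ} (hN : 1 ≤ N) (hc : 1 ≤ c) (hcK : c ≤ K) :
    (((N + 1 : ℕ) : ℝ≥0∞) * (2 * c + 1) + 2) *
        (2 * ENNReal.ofReal (Real.exp (-(3 * Real.log ((N + 1 : ℕ) : ℝ) + Real.log (K : ℝ))))) ≤
      ENNReal.ofReal (4 / ((N + 1 : ℕ) : ℝ)) := by
  have hn2 : (2 : ℝ) ≤ ((N + 1 : ℕ) : ℝ) := by exact_mod_cast Nat.succ_le_succ hN
  have hK1 : (1 : ℝ) ≤ K := by exact_mod_cast hc.trans hcK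
  have hcK' : (c : ℝ) ≤ K := by exact_mod_cast hcK
  set n : ℝ := ((N + 1 : ℕ) : ℝ) with hn
  have hn0 : 0 < n := by linarith
  have hK0 : (0 : ℝ) < K := by linarith
  have hexp : Real.exp (-(3 * Real.log n + Real.log K)) = 1 / (n ^ 3 * K) := by
    rw [Real.exp_neg, Real.exp_add, Real.exp_log hK0, one_div,
      show 3 * Real.log n = ((3 : ℕ) : ℝ) * Real.log n by norm_num, Real.exp_nat_mul,
      Real.exp_log hn0]
  have hcast : (((N + 1 : ℕ) : ℝ≥0∞) * (2 * c + 1) + 2) * (2 * ENNReal.ofReal (1 / (n ^ 3 * K))) =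
      ENNReal.ofReal ((n * (2 * c + 1) + 2) * (2 * (1 / (n ^ 3 * K)))) := by
    rw [ENNReal.ofReal_mul (by positivity), ENNReal.ofReal_mul (p := 2) zero_le_two,
      ENNReal.ofReal_add (by positivity) zero_le_two, ENNReal.ofReal_mul hn0.le,
      ENNReal.ofReal_add (by positivity) zero_le_one, ENNReal.ofReal_mul zero_le_two, hn]
    simp only [ENNReal.ofReal_natCast, ENNReal.ofReal_one, ENNReal.ofReal_ofNat]
  rw [hexp, hcast]
  refine ENNReal.ofReal_le_ofReal ?_
  have e : (n * (2 * c + 1) + 2) * (2 * (1 / (n ^ 3 * K))) =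
      (2 * (n * (2 * c + 1) + 2)) / (n ^ 3 * K) := by ring
  rw [e, div_le_div_iff₀ (by positivity) hn0]
  have h1 : n * (2 * c + 1) ≤ n * (3 * K) := mul_le_mul_of_nonneg_left (by linarith) hn0.le
  have h2 : 2 * (n * (2 * c + 1) + 2) * n ≤ 2 * (n * (3 * K) + 2) * n := by gcongr
  have h3 : 2 * (n * (3 * K) + 2) ≤ 4 * n ^ 2 * K := by
    have h4 : 2 ≤ n * K := by nlinarith
    nlinarith
  calc _ ≤ 2 * (n * (3 * K) + 2) * n := h2
    _ ≤ 4 * n ^ 2 * K * n := by gcongr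
    _ = 4 * (n ^ 3 * K) := by ring

/-- The stochastic part of the rate dominates both the deviation `√(ℓ / (n γ))` at the level
`ℓ = 3 log n + log K` and the radius `√(γ / n)` of the net. -/
theorem deviation_le_rate {n γ K : ℝ} (hn : 3 ≤ n) (hγ : 0 < γ) (hγ1 : γ ≤ 1) (hK : 1 ≤ K) :
    √((3 * Real.log n + Real.log K) / (n * γ)) ≤
        2 * (Real.log n / √(n * γ) * √(1 + Real.log K)) ∧
      √(γ / n) ≤ Real.log n / √(n * γ) * √(1 + Real.log K) ∧
      0 < Real.log n / √(n * γ) * √(1 + Real.log K) := by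
  have hn0 : 0 < n := by linarith
  have hnγ : 0 < n * γ := mul_pos hn0 hγ
  have hs : 0 < √(n * γ) := Real.sqrt_pos.2 hnγ
  have hlK : 0 ≤ Real.log K := Real.log_nonneg hK
  have hln : 1 ≤ Real.log n := by
    rw [Real.le_log_iff_exp_le hn0]
    exact (Real.exp_one_lt_d9.le.trans (by norm_num)).trans hn
  have h1K : 1 ≤ √(1 + Real.log K) := by
    rw [Real.one_le_sqrt]; linarith
  refine ⟨?_, ?_, by positivity⟩
  · rw [Real.sqrt_div' _ hnγ.le,
      show 2 * (Real.log n / √(n * γ) * √(1 + Real.log K)) =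
        (2 * Real.log n * √(1 + Real.log K)) / √(n * γ) by ring]
    refine div_le_div_of_nonneg_right ?_ hs.le
    refine Real.sqrt_le_iff.2 ⟨by positivity, ?_⟩
    rw [mul_pow, Real.sq_sqrt (by linarith)]
    nlinarith [mul_nonneg hlK (sub_nonneg.2 hln),
      mul_nonneg hlK (mul_nonneg (sub_nonneg.2 hln) (sub_nonneg.2 hln))]
  · have h1 : √(γ / n) ≤ 1 / √(n * γ) := by
      rw [← Real.sqrt_one, ← Real.sqrt_div zero_le_one]
      refine Real.sqrt_le_sqrt ?_
      rw [div_le_div_iff₀ hn0 hnγ]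
      nlinarith [mul_le_mul hγ1 hγ1 hγ.le zero_le_one]
    refine h1.trans ?_
    calc 1 / √(n * γ) ≤ Real.log n / √(n * γ) := div_le_div_of_nonneg_right hln hs.le
      _ ≤ _ := le_mul_of_one_le_right (by positivity) h1K

/-- Small radii with finite covering numbers provide finite nets at every scale. -/
theorem exists_net_of_frequently {E : Type*} {A : Set E} {V : Set (E → ℝ)} {r : ℕ → ℝ}
    (hr0 : ∀ n, 0 ≤ r n) (hr : Tendsto r atTop (𝓝 0))
    (h : ∃ᶠ n in atTop, supCoveringNumber (r n) A V ≠ ⊤) {ε : ℝ} (hε : 0 < ε) :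
    ∃ V₀ : Finset (E → ℝ), (∀ v ∈ V₀, v ∈ V) ∧
      ∀ v ∈ V, ∃ w ∈ V₀, ∀ z ∈ A, |v z - w z| ≤ ε := by
  obtain ⟨n, hn, hnε⟩ := (h.and_eventually (hr.eventually (gt_mem_nhds (half_pos hε)))).exists
  obtain ⟨V₀, hV₀, -, hnet⟩ := exists_finset_net_of_supCoveringNumber_ne_top (hr0 n) hn
  refine ⟨V₀, hV₀, fun v hv => ?_⟩
  obtain ⟨w, hw, hvw⟩ := hnet v hv
  exact ⟨w, hw, fun z hz => (hvw z hz).trans (by linarith)⟩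

theorem ofReal_one_sub_le_measure {Ω : Type*} [MeasurableSpace Ω] {μ : Measure Ω}
    [IsProbabilityMeasure μ] {A : Set Ω} {x : ℝ} (hx : 0 ≤ x) (h : μ Aᶜ ≤ ENNReal.ofReal x) :
    ENNReal.ofReal (1 - x) ≤ μ A := by
  rw [ENNReal.ofReal_sub 1 hx, ENNReal.ofReal_one, tsub_le_iff_right]
  calc (1 : ℝ≥0∞) = μ (A ∪ Aᶜ) := by rw [Set.union_compl_self, measure_univ]
    _ ≤ μ A + μ Aᶜ := measure_union_le _ _
    _ ≤ _ := by gcongr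

theorem mainTheorem1 {d : ℕ} (𝒳 : Set (EuclideanSpace ℝ (Fin d))) (𝒮 : Set ℝ)
    (h𝒮 : 𝒮.OrdConnected) (P : Measure (𝒳 × ℝ)) [IsProbabilityMeasure P]
    (k : ℝ → ℝ) (γ : ℕ → ℝ) (hk : IsKernelProfile k)
    (hPS : HasBoundedDensity (P.map Prod.snd) 𝒮) (hP : HasSmoothDensity P 𝒮)
    (hγ : Tendsto γ atTop (𝓝 0)) (hnγ : Tendsto (fun n : ℕ => (n : ℝ) * γ n) atTop atTop) :
    ∃ c : ℝ, 0 < c ∧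
      ∀ (m : ℕ) (𝒵 : Set (EuclideanSpace ℝ (Fin m))) (h : 𝒳 → EuclideanSpace ℝ (Fin m))
        (V : Set (EuclideanSpace ℝ (Fin m) → ℝ)),
        MeasurableSet 𝒵 → Measurable h → Bornology.IsBounded (Set.range h) → (∀ x, h x ∈ 𝒵) →
        V.Nonempty → (∀ v ∈ V, Measurable v ∧ ∀ z ∈ 𝒵, |v z| ≤ 1) →
        ∀ᶠ n : ℕ in atTop, supCoveringNumber √(γ n / n) 𝒵 V ≠ ⊤ →
          ENNReal.ofReal (1 - 4 / (n : ℝ)) ≤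
            (Measure.pi fun _ : Fin n => P)
              {ω | |EIPMhat V k (γ n) (fun i => h (ω i).1) (fun i => (ω i).2) -
                    EIPM V (fun w : 𝒳 × ℝ => h w.1) Prod.snd P| <
                  c * eipmRate n (γ n) (supCoveringNumber √(γ n / n) 𝒵 V)} := by
  obtain ⟨⟨D, hD⟩, ⟨a, b, hab, hsub⟩, 𝓂, L, U, B, B₁, hm⟩ :=
    exists_isSmoothDisintegration h𝒮 hPS hP
  obtain ⟨M, hM⟩ := hk.bounded
  obtain ⟨γ₀, hγ₀, hmass⟩ := exists_forall_kernel_mass_ge hk h𝒮 hab hsub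
  have hM1 : ∀ t, k t ≤ max M 1 := fun t => (hM t).trans (le_max_left _ _)
  have hM0 : 0 < max M 1 := lt_max_of_lt_right one_pos
  set C₁ := 2 * max M 1 + U / 2 with hC₁
  have hL := hm.L_pos
  have hU := hm.U_pos
  have hB := hm.B_nonneg
  have hB₁ := hm.B₁_nonneg
  have hC₁0 : 0 < C₁ := by positivity
  have hκ₁ : 0 ≤ ∫ u, k u * |u| := integral_nonneg fun u => mul_nonneg (hk.nonneg u) (abs_nonneg u)
  have hκ₂ : 0 ≤ ∫ u, u ^ 2 * k u :=
    integral_nonneg fun u => mul_nonneg (sq_nonneg u) (hk.nonneg u)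
  set Kρ := 32 * C₁ / L + 12 + 48 * B₁ * ((∫ u, k u * |u|) + 1) / L with hKρ
  set Kγ := 16 * (B + B₁ * U) * (∫ u, u ^ 2 * k u) / L with hKγ
  have hKρ0 : 0 ≤ Kρ := by positivity
  have hKγ0 : 0 ≤ Kγ := by positivity
  -- below this value of `√(ℓ / (n γ))` the concentration inequalities apply
  set ρ₀ := min 1 (L / (16 * C₁)) with hρ₀
  have hρ₀0 : 0 < ρ₀ := lt_min one_pos (by positivity)
  have h8 : 0 < 8 / ρ₀ := by positivity
  refine ⟨9 + 2 * Kρ + Kγ + 8 / ρ₀, by positivity, ?_⟩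
  intro m 𝒵 h V h𝒵 hh _ hh𝒵 hV hVm
  -- if the covering numbers are eventually infinite, nothing is claimed for large `n`; otherwise
  -- the class is totally bounded, which makes the integrand of the EIPM measurable
  by_cases hfreq : ∃ᶠ n : ℕ in atTop, supCoveringNumber √(γ n / n) 𝒵 V ≠ ⊤
  swap
  · filter_upwards [not_frequently.1 hfreq] with n hn hn'
    exact absurd hn' hn
  have hr : Tendsto (fun n : ℕ => √(γ n / n)) atTop (𝓝 0) := by
    have h1 : Tendsto (fun n : ℕ => γ n / n) atTop (𝓝 0) :=
      hγ.div_atTop tendsto_natCast_atTop_atTop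
    simpa using h1.sqrt
  have hY : Measurable fun w : 𝒳 × ℝ => h w.1 := hh.comp measurable_fst
  have hprob : IsProbabilityMeasure (P.map fun w => h w.1) :=
    Measure.isProbabilityMeasure_map hY.aemeasurable
  have hF := aemeasurable_IPM_kernel hV hVm (condDistrib (fun w : 𝒳 × ℝ => h w.1) Prod.snd P)
    (P.map fun w => h w.1) (ae_condDistrib_mem (P := P) hh h𝒵 hh𝒵)
    ((ae_map_iff hY.aemeasurable (p := fun z => z ∈ 𝒵) h𝒵).2
      (Eventually.of_forall fun w => hh𝒵 w.1))
    (fun ε hε => exists_net_of_frequently (fun _ => Real.sqrt_nonneg _) hr hfreq hε)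
  filter_upwards [eventually_ge_atTop 3, hγ.eventually (gt_mem_nhds (lt_min hγ₀ one_pos)),
    hnγ.eventually_gt_atTop 0] with n hn3 hγn hnγn hcov
  have hn3' : (3 : ℝ) ≤ n := by exact_mod_cast hn3
  have hγ0 : 0 < γ n := pos_of_mul_pos_right hnγn (by positivity)
  have hγ1 : γ n ≤ 1 := hγn.le.trans (min_le_right _ _)
  obtain ⟨V₀, hV₀, hcard, hnet⟩ :=
    exists_finset_net_of_supCoveringNumber_ne_top (Real.sqrt_nonneg _) hcov
  set K := (supCoveringNumber √(γ n / n) 𝒵 V).toNat with hK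
  have hcard1 : 1 ≤ V₀.card := by
    obtain ⟨v, hv⟩ := hV
    obtain ⟨w, hw, -⟩ := hnet v hv
    exact Finset.card_pos.2 ⟨w, hw⟩
  have hK1 : (1 : ℝ) ≤ K := by exact_mod_cast hcard1.trans hcard
  obtain ⟨hρR, hηR, hR⟩ := deviation_le_rate hn3' hγ0 hγ1 hK1
  have hrate : eipmRate n (γ n) (supCoveringNumber √(γ n / n) 𝒵 V) =
      γ n ^ 2 + Real.log n / √(n * γ n) * √(1 + Real.log K) := rfl
  set R := Real.log n / √(n * γ n) * √(1 + Real.log K) with hRdef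
  set ℓ := 3 * Real.log n + Real.log K with hℓ
  set ρ := √(ℓ / (n * γ n)) with hρ
  have hℓ0 : 0 ≤ ℓ := by
    have h1 : 0 ≤ Real.log n := Real.log_nonneg (by linarith)
    have h2 := Real.log_nonneg hK1
    positivity
  have hγ2 : 0 < γ n ^ 2 := by positivity
  refine ofReal_one_sub_le_measure (by positivity) ?_
  obtain ⟨N, rfl⟩ : ∃ N, n = N + 1 := ⟨n - 1, by omega⟩
  have hN : 1 ≤ N := by omega
  rw [hrate]
  -- for `ρ > ρ₀` the rate exceeds `ρ₀ / 2` and the trivial bound `4` on the error is enough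
  rcases le_or_gt ρ ρ₀ with hle | hgt
  · have hℓn : ℓ ≤ ((N + 1 : ℕ) : ℝ) * γ (N + 1) := by
      have h1 : ρ ≤ 1 := hle.trans (min_le_left _ _)
      rw [hρ, Real.sqrt_le_one, div_le_one hnγn] at h1
      exact h1
    have hreg : 16 * C₁ * ρ ≤ L := by
      have h1 := hle.trans (min_le_right _ _)
      rw [le_div_iff₀ (by positivity)] at h1
      linarith
    refine le_trans (measure_mono fun ω hω => ?_) ((hm.pi_not_abs_EIPMhat_sub_le h𝒮 hD hk hM0 hM1
      hγ0 hγ1 (hmass _ hγ0 (hγn.le.trans (min_le_left _ _))) hh h𝒵 hh𝒵 hV hVm hF hV₀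
      (by positivity) hnet hN hℓ0 hℓn hreg).trans (union_bound_le hN hcard1 hcard))
    rw [Set.mem_compl_iff, Set.mem_ofPred_eq] at hω
    rw [Set.mem_ofPred_eq]
    contrapose! hω
    refine hω.trans_lt ?_
    have h1 : Kρ * ρ ≤ Kρ * (2 * R) := mul_le_mul_of_nonneg_left hρR hKρ0
    have h2 : 0 ≤ (9 + 2 * Kρ + 8 / ρ₀) * γ (N + 1) ^ 2 := by positivity
    have h3 : 0 ≤ (Kγ + 8 / ρ₀) * R := by positivity
    linarith
  · have hempty : {ω : Fin (N + 1) → 𝒳 × ℝ |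
        |EIPMhat V k (γ (N + 1)) (fun i => h (ω i).1) (fun i => (ω i).2) -
          EIPM V (fun w : 𝒳 × ℝ => h w.1) Prod.snd P| <
        (9 + 2 * Kρ + Kγ + 8 / ρ₀) * (γ (N + 1) ^ 2 + R)}ᶜ = ∅ := by
      rw [Set.compl_empty_iff, Set.eq_univ_iff_forall]
      intro ω
      rw [Set.mem_ofPred_eq]
      refine (abs_EIPMhat_sub_EIPM_le hk _ hh h𝒵 hh𝒵 hV hVm ω).trans_lt ?_
      have h1 : 4 < 8 / ρ₀ * R := by
        rw [div_mul_eq_mul_div, lt_div_iff₀ hρ₀0]; linarith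
      have h2 : 0 ≤ (9 + 2 * Kρ + Kγ + 8 / ρ₀) * γ (N + 1) ^ 2 := by positivity
      have h3 : 0 ≤ (9 + 2 * Kρ + Kγ) * R := by positivity
      linarith
    rw [hempty]
    simp
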